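/- **Proposition 4.4.** Let $n\ge 1$ and let $M=(m_{ij})\in \mathrm{SL}(2n+1,\mathbb{Z})$ have a real eigenvalue $\alpha>0$, $\alpha\neq 1$, whose generalized eigenspace is one-dimensional, all other complex eigenvalues of $M$ being non-real. Let $a\in\mathbb{R}^{2n+1}$ be an eigenvector of $M$ for $\alpha$, let $W\subset\mathbb{C}^{2n+1}$ be the sum of the generalized eigenspaces of $M$ for the eigenvalues with positive imaginary part (so $\dim_{\mathbb C} W=n$), let $b_1,\dots,b_n$ be a basis of $W$, and let $R=(r_{\ell j})$ be the matrix of $M|_W$ in this basis, $Mb_j=\sum_{\ell} r_{\ell j}b_\ell$. Put $u_i=(a^{(i)},b_1^{(i)},\dots,b_n^{(i)})\in\mathbb{R}\times\mathbb{C}^n$ for $1\le i\le 2n+1$, where $x^{(i)}$ denotes the $i$-th coordinate of $x$. Let $G_M$ be the group of holomorphic automorphisms of $\mathbb{H}\times\mathbb{C}^n$ ($\mathbb{H}$ the upper half-plane) generated by $$g_0(w,z)=(\alpha w,R^{\top}z),\qquad g_i(w,z)=(w,z)+u_i\quad(1\le i\le 2n+1).$$ This group acts freely and properly discontinuously; let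 $T_M=(\mathbb{H}\times\mathbb{C}^n)/G_M$ be the quotient complex manifold, of dimension $n+1$. If $M$ is not diagonalizable over $\mathbb{C}$, then $T_M$ admits no locally conformally Kähler structure; that is, there is no pair $(\Omega,\omega)$ consisting of the fundamental form $\Omega$ of a smooth Hermitian metric on $T_M$ (a smooth positive real $(1,1)$-form) and a smooth closed real $1$-form $\omega$ on $T_M$ with $d\Omega=\omega\wedge\Omega$. -/

import Mathlib

open scoped Manifold ContDiff Matrix

noncomputable section

/-! ## Differential forms and locally conformally Kähler structures on complex manifolds -/

namespace ComplexGeometry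

section Forms

variable {E : Type*} [NormedAddCommGroup E] [NormedSpace ℝ E]

/-- A (not necessarily continuous) real `k`-form on the real manifold `X`: an alternating
`k`-linear form on every tangent space. -/
abbrev DiffForm (E : Type*) [NormedAddCommGroup E] [NormedSpace ℝ E]
    (X : Type*) [TopologicalSpace X] [ChartedSpace E X] (k : ℕ) : Type _ :=
  ∀ x : X, TangentSpace 𝓘(ℝ, E) x [⋀^Fin k]→L[ℝ] ℝ

/-- The expression of the form `η` in the chart `e`: the pull-back of `η` under `e⁻¹`, a form
on the open set `e.target` of `E` (only its values on `e.target` are meaningful). -/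
def DiffForm.inChart {X : Type*} [TopologicalSpace X] [ChartedSpace E X] {k : ℕ}
    (η : DiffForm E X k) (e : OpenPartialHomeomorph X E) (y : E) : E [⋀^Fin k]→L[ℝ] ℝ :=
  (η (e.symm y)).compContinuousLinearMap (mfderiv 𝓘(ℝ, E) 𝓘(ℝ, E) e.symm y)

/-- The wedge product of a `1`-form and a `k`-form on a vector space,
`(θ ∧ η)(v₀, …, v_k) = ∑ i, (-1)^i θ(v_i) η(v₀, …, v̂_i, …, v_k)`
(see `wedgeOne_apply`). -/
def wedgeOne {k : ℕ} (θ : E [⋀^Fin 1]→L[ℝ] ℝ) (η : E [⋀^Fin k]→L[ℝ] ℝ) :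
    E [⋀^Fin (k + 1)]→L[ℝ] ℝ :=
  ContinuousAlternatingMap.alternatizeUncurryFin
    (((ContinuousAlternatingMap.ofSubsingleton ℝ E ℝ (0 : Fin 1)).symm θ).smulRight η)

theorem wedgeOne_apply {k : ℕ} (θ : E [⋀^Fin 1]→L[ℝ] ℝ) (η : E [⋀^Fin k]→L[ℝ] ℝ)
    (v : Fin (k + 1) → E) :
    wedgeOne θ η v =
      ∑ i : Fin (k + 1), (-1 : ℝ) ^ (i : ℕ) * (θ (fun _ => v i) * η (i.removeNth v)) := by
  simp only [wedgeOne, ContinuousAlternatingMap.alternatizeUncurryFin_apply]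
  refine Finset.sum_congr rfl fun i _ => ?_
  rw [zsmul_eq_mul]
  push_cast
  rfl

end Forms

/-- A locally conformally Kähler structure on the complex manifold `X` (modelled on the complex
vector space `E`): the fundamental form `Ω` of a Hermitian metric, that is, a smooth real
`2`-form of type `(1,1)` which is positive, together with a closed smooth real `1`-form `ω`
(the Lee form) such that `dΩ = ω ∧ Ω`. All conditions are expressed in the holomorphic charts
of `X`, in which the complex structure of the tangent spaces is that of `E`. -/
structure LCKStructure (E : Type*) [NormedAddCommGroup E] [NormedSpace ℂ E]
    [NormedSpace ℝ E] [IsScalarTower ℝ ℂ E]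
    (X : Type*) [TopologicalSpace X] [ChartedSpace E X] [IsManifold 𝓘(ℂ, E) ω X] where
  /-- the fundamental form -/
  Ω : DiffForm E X 2
  /-- the Lee form -/
  lee : DiffForm E X 1
  smooth_Ω : ∀ e ∈ IsManifold.maximalAtlas 𝓘(ℂ, E) ω X,
    ContDiffOn ℝ ∞ (Ω.inChart e) e.target
  smooth_lee : ∀ e ∈ IsManifold.maximalAtlas 𝓘(ℂ, E) ω X,
    ContDiffOn ℝ ∞ (lee.inChart e) e.target
  /-- `Ω` is of type `(1,1)`: it is invariant under the complex structure. -/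
  invariant : ∀ e ∈ IsManifold.maximalAtlas 𝓘(ℂ, E) ω X, ∀ y ∈ e.target, ∀ v w : E,
    Ω.inChart e y ![Complex.I • v, Complex.I • w] = Ω.inChart e y ![v, w]
  /-- The symmetric form `(v, w) ↦ Ω (v, i w)` is positive definite. -/
  positive : ∀ e ∈ IsManifold.maximalAtlas 𝓘(ℂ, E) ω X, ∀ y ∈ e.target, ∀ v : E, v ≠ 0 →
    0 < Ω.inChart e y ![v, Complex.I • v]
  lee_closed : ∀ e ∈ IsManifold.maximalAtlas 𝓘(ℂ, E) ω X, ∀ y ∈ e.target,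
    extDeriv (lee.inChart e) y = 0
  d_Ω : ∀ e ∈ IsManifold.maximalAtlas 𝓘(ℂ, E) ω X, ∀ y ∈ e.target,
    extDeriv (Ω.inChart e) y = wedgeOne (lee.inChart e y) (Ω.inChart e y)

end ComplexGeometry

/-! ## The manifolds `T_M` -/

namespace InoueType

open Module

/-- The endomorphism of `ℂ^{2n+1}` given by the integral matrix `M`. -/
def complexEnd {n : ℕ} (M : Matrix.SpecialLinearGroup (Fin (2 * n + 1)) ℤ) :
    Module.End ℂ (Fin (2 * n + 1) → ℂ) :=
  Matrix.toLin' ((M : Matrix (Fin (2 * n + 1)) (Fin (2 * n + 1)) ℤ).map (Int.cast : ℤ → ℂ))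

/-- The matrix `M` is diagonalizable over `ℂ`. -/
def IsDiagonalizable {n : ℕ} (M : Matrix.SpecialLinearGroup (Fin (2 * n + 1)) ℤ) : Prop :=
  ∃ (P : GL (Fin (2 * n + 1)) ℂ) (d : Fin (2 * n + 1) → ℂ),
    (M : Matrix (Fin (2 * n + 1)) (Fin (2 * n + 1)) ℤ).map (Int.cast : ℤ → ℂ) =
      (P : Matrix (Fin (2 * n + 1)) (Fin (2 * n + 1)) ℂ) * Matrix.diagonal d *
        ((P⁻¹ : GL (Fin (2 * n + 1)) ℂ) : Matrix (Fin (2 * n + 1)) (Fin (2 * n + 1)) ℂ)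

/-- The sum `W` of the generalized eigenspaces of `M` for the eigenvalues with positive
imaginary part. -/
def upperSpace {n : ℕ} (M : Matrix.SpecialLinearGroup (Fin (2 * n + 1)) ℤ) :
    Submodule ℂ (Fin (2 * n + 1) → ℂ) :=
  ⨆ β ∈ {β : ℂ | 0 < β.im}, (complexEnd M).maxGenEigenspace β

theorem upperSpace_invariant {n : ℕ} (M : Matrix.SpecialLinearGroup (Fin (2 * n + 1)) ℤ)
    (x : Fin (2 * n + 1) → ℂ) (hx : x ∈ upperSpace M) : complexEnd M x ∈ upperSpace M := by
  suffices h : upperSpace M ≤ (upperSpace M).comap (complexEnd M) from h hx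
  refine iSup₂_le fun β hβ y hy => ?_
  have : complexEnd M y ∈ (complexEnd M).maxGenEigenspace β :=
    Module.End.mapsTo_maxGenEigenspace_of_comm (Commute.refl (complexEnd M)) β hy
  exact (le_iSup₂_of_le (f := fun (β : ℂ) (_ : β ∈ {β : ℂ | 0 < β.im}) =>
    (complexEnd M).maxGenEigenspace β) β hβ le_rfl) this

/-- The data from which the manifold `T_M` is constructed: a matrix `M ∈ SL(2n+1, ℤ)` with an
eigenvalue `α > 0`, `α ≠ 1`, whose eigenspace is one-dimensional, all other eigenvalues being
non-real; a real eigenvector `a` for `α`; and a basis `b₁, …, b_n` of the sum `W` of the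
generalized eigenspaces for the eigenvalues in the upper half-plane. (As `W` has dimension `n`,
the eigenvalue `α` is simple.) -/
structure Datum (n : ℕ) where
  M : Matrix.SpecialLinearGroup (Fin (2 * n + 1)) ℤ
  α : ℝ
  α_pos : 0 < α
  α_ne_one : α ≠ 1
  finrank_eigenspace : finrank ℂ ((complexEnd M).eigenspace (α : ℂ)) = 1
  im_ne_zero : ∀ β : ℂ, (complexEnd M).HasEigenvalue β → β ≠ (α : ℂ) → β.im ≠ 0
  a : Fin (2 * n + 1) → ℝ
  a_ne_zero : a ≠ 0
  a_eigen : (M : Matrix (Fin (2 * n + 1)) (Fin (2 * n + 1)) ℤ).map (Int.cast : ℤ → ℝ) *ᵥ a = α • a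
  b : Basis (Fin n) ℂ (upperSpace M)

/-- The complex manifold `ℍ × ℂ^n`, as an open subset of `ℂ × ℂ^n`. -/
def HC (n : ℕ) : TopologicalSpace.Opens (ℂ × (Fin n → ℂ)) :=
  ⟨{p | 0 < p.1.im}, isOpen_lt continuous_const (Complex.continuous_im.comp continuous_fst)⟩

theorem mem_HC {n : ℕ} {p : ℂ × (Fin n → ℂ)} : p ∈ HC n ↔ 0 < p.1.im := Iff.rfl

/-- Translation of `ℍ × ℂ^n` by a vector of `ℝ × ℂ^n`. -/
def transl {n : ℕ} (v : ℝ × (Fin n → ℂ)) : Equiv.Perm (HC n) where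
  toFun p := ⟨(p.1.1 + (v.1 : ℂ), p.1.2 + v.2), by
    have := mem_HC.1 p.2
    simpa [mem_HC] using this⟩
  invFun p := ⟨(p.1.1 - (v.1 : ℂ), p.1.2 - v.2), by
    have := mem_HC.1 p.2
    simpa [mem_HC] using this⟩
  left_inv p := by ext <;> simp
  right_inv p := by ext <;> simp

theorem transl_apply_coe {n : ℕ} (v : ℝ × (Fin n → ℂ)) (p : HC n) :
    ((transl v p : HC n) : ℂ × (Fin n → ℂ)) = (p.1.1 + (v.1 : ℂ), p.1.2 + v.2) := rfl

theorem transl_mul {n : ℕ} (v w : ℝ × (Fin n → ℂ)) : transl v * transl w = transl (v + w) := by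
  ext p <;> simp [transl_apply_coe, add_assoc, add_comm v.1, add_comm v.2]

theorem transl_zero {n : ℕ} : transl (0 : ℝ × (Fin n → ℂ)) = 1 := by
  ext p <;> simp [transl_apply_coe]

theorem transl_inv {n : ℕ} (v : ℝ × (Fin n → ℂ)) : (transl v)⁻¹ = transl (-v) := by
  rw [inv_eq_iff_mul_eq_one, transl_mul, add_neg_cancel, transl_zero]

namespace Datum

variable {n : ℕ} (D : Datum n)

/-- The matrix `R` of the restriction of `M` to `W` in the basis `b`:
`M b_j = ∑ l, R l j • b_l`. -/
def R : Matrix (Fin n) (Fin n) ℂ :=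
  LinearMap.toMatrix D.b D.b
    ((complexEnd D.M).restrict (p := upperSpace D.M) (q := upperSpace D.M)
      (upperSpace_invariant D.M))

/-- The vectors `u_i = (a^{(i)}, b_1^{(i)}, …, b_n^{(i)})` of `ℝ × ℂ^n`. -/
def u (i : Fin (2 * n + 1)) : ℝ × (Fin n → ℂ) :=
  (D.a i, fun j => (D.b j : Fin (2 * n + 1) → ℂ) i)

theorem sum_R (j : Fin n) :
    complexEnd D.M (D.b j) = ∑ l, D.R l j • (D.b l : Fin (2 * n + 1) → ℂ) := by
  have h := D.b.sum_repr ((complexEnd D.M).restrict (p := upperSpace D.M) (q := upperSpace D.M)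
    (upperSpace_invariant D.M) (D.b j))
  have h2 := congrArg (Subtype.val) h
  simp only [LinearMap.coe_restrict_apply] at h2
  rw [← h2]
  simp only [R, LinearMap.toMatrix_apply, Submodule.coe_sum, Submodule.coe_smul]

theorem complexEnd_injective (M : Matrix.SpecialLinearGroup (Fin (2 * n + 1)) ℤ) :
    Function.Injective (complexEnd M) := by
  have h : ((M⁻¹ : Matrix.SpecialLinearGroup (Fin (2 * n + 1)) ℤ) :
      Matrix (Fin (2 * n + 1)) (Fin (2 * n + 1)) ℤ).map (Int.castRingHom ℂ) *
      (M : Matrix (Fin (2 * n + 1)) (Fin (2 * n + 1)) ℤ).map (Int.castRingHom ℂ) = 1 := by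
    rw [← Matrix.map_mul, ← Matrix.SpecialLinearGroup.coe_mul]
    simp
  refine Function.LeftInverse.injective (g := complexEnd M⁻¹) fun x => ?_
  simp only [complexEnd, Matrix.toLin'_apply, Matrix.mulVec_mulVec]
  erw [h]
  simp

theorem isUnit_det_R : IsUnit D.R.det := by
  have hinj : Function.Injective ((complexEnd D.M).restrict (p := upperSpace D.M)
      (q := upperSpace D.M) (upperSpace_invariant D.M)) := fun x y hxy => by
    apply Subtype.ext
    apply complexEnd_injective D.M
    exact congrArg Subtype.val hxy
  have : FiniteDimensional ℂ (upperSpace D.M) := inferInstance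
  have h := LinearEquiv.isUnit_det (LinearEquiv.ofInjectiveEndo _ hinj) D.b D.b
  exact h

/-- The automorphism `g₀ (w, z) = (α w, Rᵀ z)` of `ℍ × ℂ^n`. -/
def g₀ : Equiv.Perm (HC n) where
  toFun p := ⟨((D.α : ℂ) * p.1.1, D.Rᵀ *ᵥ p.1.2), by
    have := mem_HC.1 p.2
    simpa [mem_HC] using mul_pos D.α_pos this⟩
  invFun p := ⟨((D.α : ℂ)⁻¹ * p.1.1, D.Rᵀ⁻¹ *ᵥ p.1.2), by
    have := mem_HC.1 p.2
    rw [← Complex.ofReal_inv]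
    simpa [mem_HC] using mul_pos (inv_pos.2 D.α_pos) this⟩
  left_inv p := by
    have hα : (D.α : ℂ) ≠ 0 := by exact_mod_cast D.α_pos.ne'
    have hR : IsUnit D.Rᵀ.det := by rw [Matrix.det_transpose]; exact D.isUnit_det_R
    ext <;> simp [hα, Matrix.nonsing_inv_mul _ hR]
  right_inv p := by
    have hα : (D.α : ℂ) ≠ 0 := by exact_mod_cast D.α_pos.ne'
    have hR : IsUnit D.Rᵀ.det := by rw [Matrix.det_transpose]; exact D.isUnit_det_R
    ext <;> simp [hα, Matrix.mul_nonsing_inv _ hR]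

/-- The group `G_M` of automorphisms of `ℍ × ℂ^n` generated by `g₀` and the translations
`g_i (w, z) = (w, z) + u_i`. -/
def G : Subgroup (Equiv.Perm (HC n)) :=
  Subgroup.closure (insert D.g₀ (Set.range fun i => transl (D.u i)))

theorem conj_complexEnd (M : Matrix.SpecialLinearGroup (Fin (2 * n + 1)) ℤ)
    (x : Fin (2 * n + 1) → ℂ) : complexEnd M (star x) = star (complexEnd M x) := by
  ext i
  simp [complexEnd, Matrix.mulVec, dotProduct]

theorem star_mem (M : Matrix.SpecialLinearGroup (Fin (2 * n + 1)) ℤ)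
    {x : Fin (2 * n + 1) → ℂ} (hx : x ∈ upperSpace M) :
    star x ∈ ⨆ β ∈ {β : ℂ | β.im < 0}, (complexEnd M).maxGenEigenspace β := by
  let C : (Fin (2 * n + 1) → ℂ) →ₛₗ[starRingEnd ℂ] (Fin (2 * n + 1) → ℂ) :=
    { toFun := star, map_add' := star_add, map_smul' := fun c x => by
        ext i; simp }
  suffices h : upperSpace M ≤
    (⨆ β ∈ {β : ℂ | β.im < 0}, (complexEnd M).maxGenEigenspace β).comap C from h hx
  refine iSup₂_le fun β hβ y hy => ?_
  have hβ' : (starRingEnd ℂ β) ∈ {β : ℂ | β.im < 0} := by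
    simpa using hβ
  refine (le_iSup₂_of_le (f := fun (β : ℂ) (_ : β ∈ {β : ℂ | β.im < 0}) =>
    (complexEnd M).maxGenEigenspace β) _ hβ' le_rfl) ?_
  rw [Module.End.mem_maxGenEigenspace] at hy ⊢
  obtain ⟨k, hk⟩ := hy
  refine ⟨k, ?_⟩
  have key : ∀ (k : ℕ) (z : Fin (2 * n + 1) → ℂ),
      ((complexEnd M - (starRingEnd ℂ β) • 1) ^ k) (star z) =
        star (((complexEnd M - β • 1) ^ k) z) := by
    intro k
    induction k with
    | zero => intro z; simp
    | succ k ih =>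
      intro z
      rw [pow_succ, pow_succ, Module.End.mul_apply, Module.End.mul_apply, ← ih]
      congr 1
      simp [conj_complexEnd]
  change ((complexEnd M - (starRingEnd ℂ β) • 1) ^ k) (star y) = 0
  rw [key, hk, star_zero]

theorem linearIndependent_u : LinearIndependent ℝ D.u := by
  rw [Fintype.linearIndependent_iff]
  intro c hc
  let φ : (Fin (2 * n + 1) → ℂ) →ₗ[ℂ] ℂ := ∑ i, (c i : ℂ) • LinearMap.proj i
  have hφ : ∀ x, φ x = ∑ i, (c i : ℂ) * x i := fun x => by simp [φ]
  have ha : φ (fun i => (D.a i : ℂ)) = 0 := by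
    have := congrArg Prod.fst hc
    rw [hφ]
    simp only [u, Prod.fst_sum, Prod.smul_fst, smul_eq_mul, Prod.fst_zero] at this
    exact_mod_cast this
  have hb : ∀ j, φ (D.b j) = 0 := fun j => by
    have := congrFun (congrArg Prod.snd hc) j
    rw [hφ]
    simpa [u, Prod.snd_sum] using this
  have hb' : ∀ j, φ (star (D.b j : Fin (2 * n + 1) → ℂ)) = 0 := fun j => by
    have := congrArg (starRingEnd ℂ) (hb j)
    rw [hφ] at this ⊢
    simpa using this
  set W' := ⨆ β ∈ {β : ℂ | β.im < 0}, (complexEnd D.M).maxGenEigenspace β with hW'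
  let L' : Submodule ℂ (Fin (2 * n + 1) → ℂ) :=
    Submodule.span ℂ (Set.range fun j => star (D.b j : Fin (2 * n + 1) → ℂ))
  let V : Submodule ℂ (Fin (2 * n + 1) → ℂ) := ℂ ∙ (fun i => (D.a i : ℂ))
  have hind := Module.End.independent_maxGenEigenspace (complexEnd D.M)
  have hL' : L' ≤ W' := by
    rw [Submodule.span_le]
    rintro _ ⟨j, rfl⟩
    exact star_mem D.M (D.b j).2
  have hV : V ≤ ⨆ β ∈ {β : ℂ | β.im = 0}, (complexEnd D.M).maxGenEigenspace β := by
    rw [Submodule.span_singleton_le_iff_mem]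
    refine (le_iSup₂_of_le (f := fun (β : ℂ) (_ : β ∈ {β : ℂ | β.im = 0}) =>
      (complexEnd D.M).maxGenEigenspace β) (D.α : ℂ) (by simp) le_rfl) ?_
    rw [Module.End.mem_maxGenEigenspace]
    refine ⟨1, ?_⟩
    have h := D.a_eigen
    ext i
    have hi := congrArg (fun x : ℝ => (x : ℂ)) (congrFun h i)
    simp only [Matrix.mulVec, dotProduct, Matrix.map_apply, Pi.smul_apply, smul_eq_mul,
      Complex.ofReal_sum, Complex.ofReal_mul, Complex.ofReal_intCast] at hi
    simp [complexEnd, Matrix.mulVec, dotProduct, hi]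
  have hdis1 : Disjoint (upperSpace D.M) L' := by
    refine Disjoint.mono_right hL' (hind.disjoint_biSup_biSup ?_)
    rw [Set.disjoint_left]
    intro β h1 h2
    simp only [Set.mem_ofPred_eq] at h1 h2
    linarith
  have hdis2 : Disjoint (upperSpace D.M ⊔ L') V := by
    have hle : upperSpace D.M ⊔ L' ≤
        ⨆ β ∈ {β : ℂ | β.im ≠ 0}, (complexEnd D.M).maxGenEigenspace β :=
      sup_le (biSup_mono fun β (hβ : 0 < β.im) => hβ.ne')
        (hL'.trans (biSup_mono fun β (hβ : β.im < 0) => hβ.ne))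
    refine Disjoint.mono hle hV (hind.disjoint_biSup_biSup ?_)
    rw [Set.disjoint_left]
    intro β h1 h2
    exact h1 h2
  have hfW : finrank ℂ (upperSpace D.M) = n := by
    rw [finrank_eq_card_basis D.b, Fintype.card_fin]
  have hfL : finrank ℂ L' = n := by
    rw [finrank_span_eq_card, Fintype.card_fin]
    have hli : LinearIndependent ℂ (fun j => (D.b j : Fin (2 * n + 1) → ℂ)) :=
      D.b.linearIndependent.map' (upperSpace D.M).subtype (Submodule.ker_subtype _)
    rw [Fintype.linearIndependent_iff] at hli ⊢
    intro g hg j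
    have h1 := hli (fun j => star (g j)) (by
      have := congrArg star hg
      simpa [star_sum] using this) j
    simpa using h1
  have hfV : finrank ℂ V = 1 := by
    refine finrank_span_singleton fun h => D.a_ne_zero ?_
    ext i
    simpa using congrFun h i
  have htop : (upperSpace D.M ⊔ L') ⊔ V = ⊤ := by
    apply Submodule.eq_top_of_finrank_eq
    have h1 := Submodule.finrank_sup_add_finrank_inf_eq (upperSpace D.M) L'
    have h2 := Submodule.finrank_sup_add_finrank_inf_eq (upperSpace D.M ⊔ L') V
    rw [hdis1.eq_bot, finrank_bot] at h1
    rw [hdis2.eq_bot, finrank_bot] at h2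
    rw [finrank_fin_fun]
    omega
  have hker : (⊤ : Submodule ℂ (Fin (2 * n + 1) → ℂ)) ≤ LinearMap.ker φ := by
    rw [← htop]
    refine sup_le (sup_le ?_ ?_) ?_
    · have : upperSpace D.M = Submodule.span ℂ
          (Set.range fun j => (D.b j : Fin (2 * n + 1) → ℂ)) := by
        have h := congrArg (Submodule.map (upperSpace D.M).subtype) D.b.span_eq
        rw [Submodule.map_span, Submodule.map_top, Submodule.range_subtype, ← Set.range_comp] at h
        exact h.symm
      rw [this, Submodule.span_le]
      rintro _ ⟨j, rfl⟩
      exact hb j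
    · rw [Submodule.span_le]
      rintro _ ⟨j, rfl⟩
      exact hb' j
    · rw [Submodule.span_singleton_le_iff_mem]
      exact ha
  intro i
  have := hker (x := Pi.single i 1) trivial
  rw [LinearMap.mem_ker, hφ] at this
  simpa [Pi.single_apply] using this

theorem g₀_apply_coe (p : HC n) :
    ((D.g₀ p : HC n) : ℂ × (Fin n → ℂ)) = ((D.α : ℂ) * p.1.1, D.Rᵀ *ᵥ p.1.2) := rfl

theorem g₀_inv_apply_coe (p : HC n) :
    ((D.g₀⁻¹ p : HC n) : ℂ × (Fin n → ℂ)) = ((D.α : ℂ)⁻¹ * p.1.1, D.Rᵀ⁻¹ *ᵥ p.1.2) := rfl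

/-- The real linear map `(x, z) ↦ (α x, Rᵀ z)` of `ℝ × ℂ^n`. -/
def A : (ℝ × (Fin n → ℂ)) →ₗ[ℝ] (ℝ × (Fin n → ℂ)) where
  toFun v := (D.α * v.1, D.Rᵀ *ᵥ v.2)
  map_add' v w := by simp [mul_add, Matrix.mulVec_add]
  map_smul' c v := by
    ext <;> simp [Matrix.mulVec_smul, mul_left_comm]

theorem A_apply (v : ℝ × (Fin n → ℂ)) : D.A v = (D.α * v.1, D.Rᵀ *ᵥ v.2) := rfl

/-- The lattice spanned by the vectors `u_i`. -/
def lattice : Submodule ℤ (ℝ × (Fin n → ℂ)) := Submodule.span ℤ (Set.range D.u)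

theorem A_u (i : Fin (2 * n + 1)) :
    D.A (D.u i) = ∑ j, (D.M : Matrix (Fin (2 * n + 1)) (Fin (2 * n + 1)) ℤ) i j • D.u j := by
  ext k
  · have h := congrFun D.a_eigen i
    simp only [Matrix.mulVec, dotProduct, Matrix.map_apply, Pi.smul_apply, smul_eq_mul] at h
    simp [A_apply, u, Prod.fst_sum, ← h]
  · have h := congrFun (D.sum_R k) i
    simp only [complexEnd, Matrix.toLin'_apply, Matrix.mulVec, dotProduct, Matrix.map_apply,
      Finset.sum_apply, Pi.smul_apply, smul_eq_mul] at h
    simp [A_apply, u, Prod.snd_sum, Matrix.mulVec, dotProduct, h]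

theorem A_mem {v : ℝ × (Fin n → ℂ)} (hv : v ∈ D.lattice) : D.A v ∈ D.lattice := by
  induction hv using Submodule.span_induction with
  | mem x hx =>
    obtain ⟨i, rfl⟩ := hx
    rw [A_u]
    exact Submodule.sum_mem _ fun j _ => Submodule.smul_mem _ _
      (Submodule.subset_span ⟨j, rfl⟩)
  | zero => simp
  | add x y _ _ hx hy => rw [map_add]; exact add_mem hx hy
  | smul c x _ hx => rw [map_zsmul]; exact Submodule.smul_mem _ _ hx

theorem exists_A_eq {v : ℝ × (Fin n → ℂ)} (hv : v ∈ D.lattice) :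
    ∃ w ∈ D.lattice, D.A w = v := by
  induction hv using Submodule.span_induction with
  | mem x hx =>
    obtain ⟨i, rfl⟩ := hx
    refine ⟨∑ j, ((D.M⁻¹ : Matrix.SpecialLinearGroup (Fin (2 * n + 1)) ℤ) :
      Matrix (Fin (2 * n + 1)) (Fin (2 * n + 1)) ℤ) i j • D.u j,
      Submodule.sum_mem _ fun j _ => Submodule.smul_mem _ _ (Submodule.subset_span ⟨j, rfl⟩), ?_⟩
    rw [map_sum]
    simp_rw [map_zsmul, A_u, Finset.smul_sum, smul_smul]
    rw [Finset.sum_comm]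
    simp_rw [← Finset.sum_smul, ← Matrix.mul_apply, ← Matrix.SpecialLinearGroup.coe_mul]
    simp [Matrix.one_apply]
  | zero => exact ⟨0, zero_mem _, map_zero _⟩
  | add x y _ _ hx hy =>
    obtain ⟨x', hx', rfl⟩ := hx
    obtain ⟨y', hy', rfl⟩ := hy
    exact ⟨x' + y', add_mem hx' hy', map_add _ _ _⟩
  | smul c x _ hx =>
    obtain ⟨x', hx', rfl⟩ := hx
    exact ⟨c • x', Submodule.smul_mem _ _ hx', map_zsmul _ _ _⟩

theorem g₀_mul_transl (v : ℝ × (Fin n → ℂ)) :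
    D.g₀ * transl v = transl (D.A v) * D.g₀ := by
  ext p <;> simp [transl_apply_coe, g₀_apply_coe, A_apply, mul_add, Matrix.mulVec_add]

theorem exists_zpow_mul_transl (k : ℤ) : ∀ {v : ℝ × (Fin n → ℂ)}, v ∈ D.lattice →
    ∃ w ∈ D.lattice, D.g₀ ^ k * transl v = transl w * D.g₀ ^ k := by
  induction k using Int.induction_on with
  | zero => intro v hv; exact ⟨v, hv, by simp⟩
  | succ k ih =>
    intro v hv
    obtain ⟨w, hw, h⟩ := ih (D.A_mem hv)
    refine ⟨w, hw, ?_⟩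
    rw [zpow_add, zpow_one, mul_assoc, g₀_mul_transl, ← mul_assoc, h, mul_assoc]
  | pred k ih =>
    intro v hv
    obtain ⟨v', hv', rfl⟩ := D.exists_A_eq hv
    obtain ⟨w, hw, h⟩ := ih hv'
    refine ⟨w, hw, ?_⟩
    have h1 : D.g₀⁻¹ * transl (D.A v') = transl v' * D.g₀⁻¹ := by
      rw [inv_mul_eq_iff_eq_mul, ← mul_assoc, g₀_mul_transl, mul_assoc, mul_inv_cancel, mul_one]
    rw [zpow_sub_one, mul_assoc, h1, ← mul_assoc, h, mul_assoc]

theorem mem_G {g : Equiv.Perm (HC n)} (hg : g ∈ D.G) :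
    ∃ (k : ℤ), ∃ v ∈ D.lattice, g = transl v * D.g₀ ^ k := by
  induction hg using Subgroup.closure_induction with
  | mem x hx =>
    rcases hx with rfl | ⟨i, rfl⟩
    · exact ⟨1, 0, zero_mem _, by simp [transl_zero]⟩
    · exact ⟨0, D.u i, Submodule.subset_span ⟨i, rfl⟩, by simp⟩
  | one => exact ⟨0, 0, zero_mem _, by simp [transl_zero]⟩
  | mul x y _ _ hx hy =>
    obtain ⟨k, v, hv, rfl⟩ := hx
    obtain ⟨l, w, hw, rfl⟩ := hy
    obtain ⟨w', hw', h⟩ := D.exists_zpow_mul_transl k hw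
    refine ⟨k + l, v + w', add_mem hv hw', ?_⟩
    rw [zpow_add, ← transl_mul, mul_assoc, ← mul_assoc (D.g₀ ^ k), h]
    simp only [mul_assoc]
  | inv x _ hx =>
    obtain ⟨k, v, hv, rfl⟩ := hx
    obtain ⟨w, hw, h⟩ := D.exists_zpow_mul_transl (-k) (neg_mem hv)
    refine ⟨-k, w, hw, ?_⟩
    rw [mul_inv_rev, transl_inv, ← zpow_neg, h]

theorem im_zpow (k : ℤ) : ∀ p : HC n, ((D.g₀ ^ k) p).1.1.im = D.α ^ k * p.1.1.im := by
  have hα := D.α_pos.ne'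
  induction k using Int.induction_on with
  | zero => intro p; simp
  | succ k ih =>
    intro p
    rw [zpow_add_one, Equiv.Perm.mul_apply, ih, g₀_apply_coe, zpow_add_one₀ hα]
    simp [mul_assoc]
  | pred k ih =>
    intro p
    rw [zpow_sub_one, Equiv.Perm.mul_apply, ih, g₀_inv_apply_coe, zpow_sub_one₀ hα,
      ← Complex.ofReal_inv]
    simp [mul_assoc]

theorem im_transl (v : ℝ × (Fin n → ℂ)) (p : HC n) : (transl v p).1.1.im = p.1.1.im := by
  simp [transl_apply_coe]

theorem zpow_α_injective : Function.Injective fun k : ℤ => D.α ^ k :=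
  zpow_right_injective₀ D.α_pos D.α_ne_one

/-- Every element of `G_M` is the restriction of an affine transformation of `ℂ × ℂ^n`. -/
theorem exists_affine {g : Equiv.Perm (HC n)} (hg : g ∈ D.G) :
    ∃ (B : (ℂ × (Fin n → ℂ)) →L[ℂ] (ℂ × (Fin n → ℂ))) (c : ℂ × (Fin n → ℂ)),
      ∀ p : HC n, ((g p : HC n) : ℂ × (Fin n → ℂ)) = B p + c := by
  let lin (s : ℂ) (N : Matrix (Fin n) (Fin n) ℂ) :
      (ℂ × (Fin n → ℂ)) →L[ℂ] (ℂ × (Fin n → ℂ)) :=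
    LinearMap.toContinuousLinearMap (LinearMap.prodMap (s • LinearMap.id) (Matrix.toLin' N))
  obtain ⟨k, v, -, rfl⟩ := D.mem_G hg
  clear hg
  suffices h : ∃ (B : (ℂ × (Fin n → ℂ)) →L[ℂ] (ℂ × (Fin n → ℂ))),
      ∀ p : HC n, (((D.g₀ ^ k) p : HC n) : ℂ × (Fin n → ℂ)) = B p by
    obtain ⟨B, hB⟩ := h
    refine ⟨B, ((v.1 : ℂ), v.2), fun p => ?_⟩
    rw [Equiv.Perm.mul_apply, transl_apply_coe, hB]
    rfl
  induction k using Int.induction_on with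
  | zero => exact ⟨ContinuousLinearMap.id ℂ _, fun p => by simp⟩
  | succ k ih =>
    obtain ⟨B, hB⟩ := ih
    refine ⟨B.comp (lin D.α D.Rᵀ), fun p => ?_⟩
    rw [zpow_add_one, Equiv.Perm.mul_apply, hB, g₀_apply_coe]
    simp [lin, LinearMap.prodMap_apply]
  | pred k ih =>
    obtain ⟨B, hB⟩ := ih
    refine ⟨B.comp (lin (D.α : ℂ)⁻¹ D.Rᵀ⁻¹), fun p => ?_⟩
    rw [zpow_sub_one, Equiv.Perm.mul_apply, hB, g₀_inv_apply_coe]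
    simp [lin, LinearMap.prodMap_apply]

instance continuousConstSMul_G : ContinuousConstSMul D.G (HC n) where
  continuous_const_smul g := by
    obtain ⟨B, c, h⟩ := D.exists_affine g.2
    refine Continuous.subtype_mk (f := fun p : HC n => ((g.1 p : HC n) : ℂ × (Fin n → ℂ))) ?_ _
    simp_rw [h]
    fun_prop

instance isCancelSMul_G : IsCancelSMul D.G (HC n) := by
  rw [isCancelSMul_iff_eq_one_of_smul_eq]
  rintro ⟨g, hg⟩ p hgp
  apply Subtype.ext
  change g p = p at hgp
  change g = 1
  obtain ⟨k, v, hv, rfl⟩ := D.mem_G hg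
  have him := congrArg (fun q : HC n => q.1.1.im) hgp
  simp only [Equiv.Perm.mul_apply, im_transl, im_zpow] at him
  have hp : 0 < p.1.1.im := mem_HC.1 p.2
  have hk : k = 0 := D.zpow_α_injective (by
    simpa [hp.ne'] using him)
  subst hk
  have hv0 : v = 0 := by
    have h := congrArg (fun q : HC n => q.1) hgp
    simp only [zpow_zero, mul_one, transl_apply_coe] at h
    ext1
    · simpa using congrArg Prod.fst h
    · simpa using congrArg Prod.snd h
  simp [hv0, transl_zero]

theorem finite_lattice_inter {s : Set (ℝ × (Fin n → ℂ))} (hs : Bornology.IsBounded s) :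
    (s ∩ D.lattice).Finite := by
  have hcard : Fintype.card (Fin (2 * n + 1)) = finrank ℝ (ℝ × (Fin n → ℂ)) := by
    simp [Module.finrank_pi_fintype, Complex.finrank_real_complex]
    ring
  let bas := basisOfLinearIndependentOfCardEqFinrank D.linearIndependent_u hcard
  have h := ZSpan.setFinite_inter bas hs
  rwa [coe_basisOfLinearIndependentOfCardEqFinrank] at h

instance properlyDiscontinuousSMul_G : ProperlyDiscontinuousSMul D.G (HC n) where
  finite_disjoint_inter_image := by
    intro K L hK hL
    have hbdd : ∃ m C : ℝ, 0 < m ∧ ∀ p ∈ K ∪ L, m ≤ p.1.1.im ∧ p.1.1.im ≤ C := by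
      rcases (K ∪ L).eq_empty_or_nonempty with h | h
      · exact ⟨1, 0, one_pos, by simp [h]⟩
      have hc : ContinuousOn (fun p : HC n => p.1.1.im) (K ∪ L) := by fun_prop
      obtain ⟨p, -, hp⟩ := (hK.union hL).exists_isMinOn h hc
      obtain ⟨q, -, hq⟩ := (hK.union hL).exists_isMaxOn h hc
      exact ⟨p.1.1.im, q.1.1.im, mem_HC.1 p.2, fun x hx => ⟨hp hx, hq hx⟩⟩
    obtain ⟨m, C, hm, hmC⟩ := hbdd
    have hlog : Real.log D.α ≠ 0 :=
      Real.log_ne_zero_of_pos_of_ne_one D.α_pos D.α_ne_one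
    let N : ℕ := ⌈(Real.log C - Real.log m) / |Real.log D.α|⌉₊
    let S : ℤ → Set (ℝ × (Fin n → ℂ)) := fun k =>
      (fun pq : HC n × HC n => (pq.2.1.1.re - ((D.g₀ ^ k) pq.1).1.1.re,
        pq.2.1.2 - ((D.g₀ ^ k) pq.1).1.2)) '' (K ×ˢ L)
    have hg₀ : D.g₀ ∈ D.G := Subgroup.subset_closure (Set.mem_insert _ _)
    have hS : ∀ k, Bornology.IsBounded (S k) := fun k => by
      have hcont : Continuous (D.g₀ ^ k) :=
        continuous_const_smul (⟨D.g₀ ^ k, D.G.zpow_mem hg₀ k⟩ : D.G)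
      exact ((hK.prod hL).image (by fun_prop)).isBounded
    have hfin : (⋃ k ∈ Set.Icc (-(N : ℤ)) N,
        (fun v => transl v * D.g₀ ^ k) '' (S k ∩ D.lattice)).Finite :=
      (Set.finite_Icc _ _).biUnion fun k _ => (D.finite_lattice_inter (hS k)).image _
    refine (hfin.preimage (f := (Subtype.val : D.G → Equiv.Perm (HC n)))
      Subtype.val_injective.injOn).subset ?_
    rintro ⟨g, hg⟩ ⟨q, ⟨p, hp, hpq⟩, hq⟩
    change g p = q at hpq
    obtain ⟨k, v, hv, rfl⟩ := D.mem_G hg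
    simp only [Set.mem_preimage, Set.mem_iUnion]
    refine ⟨k, ?_, v, ⟨⟨(p, q), ⟨hp, hq⟩, ?_⟩, hv⟩, rfl⟩
    · have him := congrArg (fun q : HC n => q.1.1.im) hpq
      simp only [Equiv.Perm.mul_apply, im_transl, im_zpow] at him
      obtain ⟨hp1, hp2⟩ := hmC p (Or.inl hp)
      obtain ⟨hq1, hq2⟩ := hmC q (Or.inr hq)
      have hlogs := congrArg Real.log him
      rw [Real.log_mul (zpow_pos D.α_pos k).ne' (hm.trans_le hp1).ne', Real.log_zpow] at hlogs
      have l1 := Real.log_le_log hm hp1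
      have l2 := Real.log_le_log (hm.trans_le hp1) hp2
      have l3 := Real.log_le_log hm hq1
      have l4 := Real.log_le_log (hm.trans_le hq1) hq2
      have habs : |(k : ℝ)| ≤ N := by
        refine le_trans ?_ (Nat.le_ceil _)
        rw [le_div_iff₀ (abs_pos.2 hlog), ← abs_mul, abs_le]
        constructor <;> linarith
      rw [abs_le] at habs
      constructor
      · exact_mod_cast habs.1
      · exact_mod_cast habs.2
    · rw [← hpq, Equiv.Perm.mul_apply]
      ext1 <;> simp [transl_apply_coe]

/-- The manifold `T_M = (ℍ × ℂ^n) / G_M`. -/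
abbrev T : Type := MulAction.orbitRel.Quotient D.G (HC n)

instance locallyCompactSpace_HC : LocallyCompactSpace (HC n) :=
  (HC n).isOpen.locallyCompactSpace

theorem chartAt_symm_coe (q : HC n) {y : ℂ × (Fin n → ℂ)}
    (hy : y ∈ (chartAt (ℂ × (Fin n → ℂ)) q).target) :
    (((chartAt (ℂ × (Fin n → ℂ)) q).symm y : HC n) : ℂ × (Fin n → ℂ)) = y :=
  (chartAt (ℂ × (Fin n → ℂ)) q).right_inv hy

theorem isLocalHomeomorph_mk :
    IsLocalHomeomorph (Quotient.mk (MulAction.orbitRel D.G (HC n))) :=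
  isQuotientCoveringMap_quotientMk_of_properlyDiscontinuousSMul.isCoveringMap.isLocalHomeomorph

/-- The transition maps between the charts of `T_M` are locally restrictions of affine maps. -/
theorem contDiffOn_transition (p p' : HC n) :
    ContDiffOn ℂ ω
      (((D.isLocalHomeomorph_mk.localInverseAt p).trans (chartAt (ℂ × (Fin n → ℂ)) p)).symm.trans
        ((D.isLocalHomeomorph_mk.localInverseAt p').trans (chartAt (ℂ × (Fin n → ℂ)) p')))
      (((D.isLocalHomeomorph_mk.localInverseAt p).trans (chartAt (ℂ × (Fin n → ℂ)) p)).symm.trans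
        ((D.isLocalHomeomorph_mk.localInverseAt p').trans
          (chartAt (ℂ × (Fin n → ℂ)) p'))).source := by
  set s := D.isLocalHomeomorph_mk.localInverseAt p with hs
  set s' := D.isLocalHomeomorph_mk.localInverseAt p' with hs'
  set c := chartAt (ℂ × (Fin n → ℂ)) p with hc
  have hsymm : ∀ q, s.symm q = Quotient.mk (MulAction.orbitRel D.G (HC n)) q := fun q =>
    congrFun (D.isLocalHomeomorph_mk.localInverseAt_symm (x := p)) q
  have hsymm' : ∀ q, s'.symm q = Quotient.mk (MulAction.orbitRel D.G (HC n)) q := fun q =>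
    congrFun (D.isLocalHomeomorph_mk.localInverseAt_symm (x := p')) q
  intro y hy
  have hyc : y ∈ c.target := by
    have := hy.1
    exact this.1
  have hys : Quotient.mk (MulAction.orbitRel D.G (HC n)) (c.symm y) ∈ s'.source := by
    have := hy.2.1
    rw [← hsymm]
    exact this
  have hq : Quotient.mk (MulAction.orbitRel D.G (HC n))
      (s' (Quotient.mk (MulAction.orbitRel D.G (HC n)) (c.symm y))) =
      Quotient.mk (MulAction.orbitRel D.G (HC n)) (c.symm y) := by
    rw [← hsymm']
    exact s'.left_inv hys
  obtain ⟨g, hg⟩ := MulAction.orbitRel_apply.1 (Quotient.exact hq)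
  change g • c.symm y = _ at hg
  obtain ⟨B, d, hB⟩ := D.exists_affine g.2
  have hcont : ContinuousAt (fun y' => g • c.symm y') y :=
    ((continuous_const_smul g).continuousAt).comp (c.symm.continuousAt hyc)
  have hmem : g • c.symm y ∈ s'.target := by
    rw [hg]
    exact s'.map_source hys
  have hev : ∀ᶠ y' in nhds y, g • c.symm y' ∈ s'.target :=
    hcont.eventually (s'.open_target.mem_nhds hmem)
  have hev2 : ∀ᶠ y' in nhds y, y' ∈ c.target := c.open_target.mem_nhds hyc
  have haff : ContDiffAt ℂ ω (fun y' => B y' + d) y := by fun_prop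
  refine (haff.congr_of_eventuallyEq ?_).contDiffWithinAt
  filter_upwards [hev, hev2] with y' h1 h2
  change ((s' (s.symm (c.symm y')) : HC n) : ℂ × (Fin n → ℂ)) = _
  have h3 : Quotient.mk (MulAction.orbitRel D.G (HC n)) (c.symm y') =
      Quotient.mk (MulAction.orbitRel D.G (HC n)) (g • c.symm y') :=
    Quotient.sound (MulAction.orbitRel_apply.2 ⟨g⁻¹, inv_smul_smul g _⟩)
  rw [hsymm, h3, ← hsymm', s'.right_inv h1]
  refine (hB (c.symm y')).trans ?_
  rw [chartAt_symm_coe p h2]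

instance isManifold_T : IsManifold 𝓘(ℂ, ℂ × (Fin n → ℂ)) ω D.T := by
  refine isManifold_of_contDiffOn _ _ _ ?_
  rintro _ _ ⟨x, rfl⟩ ⟨x', rfl⟩
  simpa using! D.contDiffOn_transition _ _

end Datum

end InoueType

end

/-! Suppose `T_M` carries `(Ω, ω)`. On the convex set `ℍ × ℂⁿ` the lifted Lee form is exact, equal
to `df`, so `e^{-f} Ω` is closed, and every element of `G_M` changes `f` by a constant. On the
lattice of translations these constants form an additive character that conjugation by `g₀`
preserves, hence a vector fixed by `M`. As 1 is not an eigenvalue of `M`, the character vanishes and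
`f` is lattice-periodic (`primitive_add_incl`).

Now average the coefficients of `e^{-f} Ω` on constant horizontal vectors over the torus `{Im w = t}
/ lattice`. The average does not depend on `t`: closedness writes its vertical derivative through
horizontal derivatives of periodic functions, and these integrate to zero
(`mean_eq_of_fderiv_vert`). The map `g₀` carries the torus over `t` to the one over `α t`, preserves
volume because `det M = 1`, and scales `e^{-f} Ω` by a constant. So the average of `Ω(x, i y)`
weighted by `e^{-f}` is a positive definite symmetric form on `ℂⁿ` which `Rᵀ` multiplies by a
constant (`exists_similitude`).

A similitude is semisimple, since orthogonal complements of invariant subspaces are invariant. In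
the real basis `u_i` of `ℝ × ℂⁿ` the map `α ⊕ Rᵀ` has matrix `Mᵀ`, so a squarefree real polynomial
kills `M`, and `M` is diagonalizable over `ℂ`. -/

noncomputable section

/-! ### Linear algebra: similitudes, semisimplicity, diagonalizability. -/

/-- A similitude of a positive definite symmetric bilinear form is semisimple. -/
theorem Module.End.isSemisimple_of_similitude {V : Type*} [AddCommGroup V] [Module ℝ V]
    [FiniteDimensional ℝ V] (B : LinearMap.BilinForm ℝ V) (hsymm : ∀ x y, B x y = B y x)
    (hpos : ∀ x, x ≠ 0 → 0 < B x x) (N : Module.End ℝ V) {c : ℝ} (hc : c ≠ 0)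
    (hN : ∀ x y, B (N x) (N y) = c * B x y) : N.IsSemisimple := by
  have hinj : Function.Injective N := by
    rw [injective_iff_map_eq_zero]
    intro x hx
    by_contra hx0
    have h := hN x x
    rw [hx, map_zero] at h
    exact (mul_ne_zero hc (hpos x hx0).ne') h.symm
  rw [Module.End.isSemisimple_iff]
  intro p hp
  refine ⟨B.orthogonal p, fun y hy => ?_, ?_⟩
  · have hmap : p.map N = p := by
      refine Submodule.eq_of_le_of_finrank_eq (Submodule.map_le_iff_le_comap.2 hp) ?_
      exact (Submodule.equivMapOfInjective N hinj p).symm.finrank_eq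
    rw [Submodule.mem_comap, LinearMap.BilinForm.mem_orthogonal_iff]
    intro x hx
    rw [← hmap] at hx
    obtain ⟨x', hx', rfl⟩ := hx
    rw [LinearMap.BilinForm.mem_orthogonal_iff] at hy
    have := hy x' hx'
    change B x' y = 0 at this
    change B (N x') (N y) = 0
    rw [hN, this, mul_zero]
  · have hrefl : B.IsRefl := fun x y h => by rw [hsymm, h]
    refine (LinearMap.BilinForm.restrict_nondegenerate_iff_isCompl_orthogonal hrefl).1 ?_
    have key : ∀ x : p, (∀ y : p, B x y = 0) → x = 0 := fun x hx => by
      by_contra hx0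
      exact (hpos x (by simpa using hx0)).ne' (hx x)
    exact ⟨fun x hx => key x hx, fun x hx => key x fun y => by rw [hsymm]; exact hx y⟩

open Polynomial in
/-- The direct sum of a scalar and a semisimple endomorphism is killed by a squarefree
polynomial. -/
theorem exists_squarefree_aeval_prodMap {K V : Type*} [Field K] [AddCommGroup V] [Module K V]
    [FiniteDimensional K V] {N : Module.End K V} (hN : N.IsSemisimple) (a : K) :
    ∃ q : K[X], Squarefree q ∧ q.eval a = 0 ∧ aeval N q = 0 := by
  -- If `a` is already a root, a further factor `X - a` would destroy squarefreeness.
  by_cases h : (minpoly K N).eval a = 0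
  · exact ⟨minpoly K N, hN.minpoly_squarefree, h, minpoly.aeval K N⟩
  · refine ⟨(X - C a) * minpoly K N, ?_, by simp, by simp⟩
    have hcop : IsCoprime (X - C a) (minpoly K N) :=
      (irreducible_X_sub_C a).coprime_iff_not_dvd.2 fun hd => h (dvd_iff_isRoot.1 hd)
    exact squarefree_mul_iff.2
      ⟨hcop.isRelPrime, (irreducible_X_sub_C a).squarefree, hN.minpoly_squarefree⟩

/-- A matrix of a semisimple endomorphism over an algebraically closed field is diagonalizable. -/
theorem Matrix.exists_eq_conj_diagonal {K ι : Type*} [Field K] [IsAlgClosed K] [Fintype ι]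
    [DecidableEq ι] (M : Matrix ι ι K) (hM : Module.End.IsSemisimple (Matrix.toLin' M)) :
    ∃ (P : GL ι K) (d : ι → K),
      M = (P : Matrix ι ι K) * Matrix.diagonal d * ((P⁻¹ : GL ι K) : Matrix ι ι K) := by
  set f := Matrix.toLin' M with hf
  set s : Set (ι → K) := {x | ∃ μ : K, f x = μ • x} with hs
  have hspan : ⊤ ≤ Submodule.span K s := by
    rw [← hM.iSup_eigenspace_eq_top]
    refine iSup_le fun μ x hx => Submodule.subset_span ⟨μ, ?_⟩
    exact Module.End.mem_eigenspace_iff.1 hx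
  let b₀ := Module.Basis.ofSpan hspan
  let b := b₀.reindex (b₀.indexEquiv (Pi.basisFun K ι))
  have hb : ∀ i, ∃ μ : K, f (b i) = μ • b i := fun i => by
    have h : b i ∈ Set.range b₀ := by
      rw [Module.Basis.reindex_apply]
      exact ⟨_, rfl⟩
    exact Module.Basis.ofSpan_subset hspan h
  choose d hd using hb
  let e := Pi.basisFun K ι
  have h1 : e.toMatrix b * b.toMatrix e = 1 := Module.Basis.toMatrix_mul_toMatrix_flip _ _
  have h2 : b.toMatrix e * e.toMatrix b = 1 := Module.Basis.toMatrix_mul_toMatrix_flip _ _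
  have h3 : LinearMap.toMatrix b b f = Matrix.diagonal d := by
    ext i j
    rw [LinearMap.toMatrix_apply, hd]
    by_cases h : i = j
    · subst h; simp
    · simp [h]
  refine ⟨⟨e.toMatrix b, b.toMatrix e, h1, h2⟩, d, ?_⟩
  change M = e.toMatrix b * Matrix.diagonal d * b.toMatrix e
  rw [← h3, basis_toMatrix_mul_linearMap_toMatrix_mul_basis_toMatrix]
  simp [e, hf, LinearMap.toMatrix_eq_toMatrix']

open Polynomial in
/-- A real matrix that is killed by a squarefree real polynomial is semisimple over `ℂ`. -/
theorem Matrix.isSemisimple_map_ofReal {ι : Type*} [Fintype ι] [DecidableEq ι]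
    (M : Matrix ι ι ℝ) {q : ℝ[X]} (hq : Squarefree q) (h : aeval M q = 0) :
    Module.End.IsSemisimple (Matrix.toLin' (M.map ((↑) : ℝ → ℂ))) := by
  -- Over the perfect field `ℝ` squarefree means separable, and separability survives the extension
  -- to `ℂ`.
  have hsep : (q.map (algebraMap ℝ ℂ)).Separable := (PerfectField.separable_iff_squarefree.2 hq).map
  refine Module.End.isSemisimple_of_squarefree_aeval_eq_zero hsep.squarefree ?_
  have h1 : aeval (M.map ((↑) : ℝ → ℂ)) q = 0 := by
    have h2 := aeval_algHom_apply (Complex.ofRealAm.mapMatrix (m := ι)) M q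
    rw [h, map_zero] at h2
    exact h2
  rw [← aeval_map_algebraMap ℂ] at h1
  have h3 := aeval_algHom_apply (Matrix.toLinAlgEquiv' (R := ℂ) (n := ι)).toAlgHom
    (M.map ((↑) : ℝ → ℂ)) (q.map (algebraMap ℝ ℂ))
  rw [h1, map_zero] at h3
  exact h3

/-! ### The lattice automorphism `α ⊕ Rᵀ` and its relation to `M`. -/

namespace InoueType

namespace Datum

variable {n : ℕ} (D : Datum n)

theorem card_eq_finrank : Fintype.card (Fin (2 * n + 1)) =
    Module.finrank ℝ (ℝ × (Fin n → ℂ)) := by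
  simp [Module.finrank_pi_fintype, Complex.finrank_real_complex]
  ring

/-- The vectors `u_i` as a real basis of `ℝ × ℂ^n`. -/
def basisU : Module.Basis (Fin (2 * n + 1)) ℝ (ℝ × (Fin n → ℂ)) :=
  basisOfLinearIndependentOfCardEqFinrank D.linearIndependent_u card_eq_finrank

theorem basisU_apply (i : Fin (2 * n + 1)) : D.basisU i = D.u i := by
  simp [basisU]

/-- The real linear endomorphism `z ↦ Rᵀ z` of `ℂ^n`. -/
def N : Module.End ℝ (Fin n → ℂ) := (Matrix.toLin' D.Rᵀ).restrictScalars ℝ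

theorem N_apply (z : Fin n → ℂ) : D.N z = D.Rᵀ *ᵥ z := rfl

/-- The transpose appears because `A_u` expands `A u_i` along the `i`-th row of `M`. -/
theorem toMatrix_A : LinearMap.toMatrix D.basisU D.basisU D.A =
    ((D.M : Matrix (Fin (2 * n + 1)) (Fin (2 * n + 1)) ℤ).map (Int.cast : ℤ → ℝ))ᵀ := by
  ext i j
  rw [LinearMap.toMatrix_apply, basisU_apply, A_u]
  simp_rw [← basisU_apply, map_sum, ← Int.cast_smul_eq_zsmul ℝ, map_smul, Module.Basis.repr_self]
  simp [Finsupp.single_apply]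

/-- This makes `A` volume preserving on the torus. -/
theorem det_A : LinearMap.det D.A = 1 := by
  rw [← LinearMap.det_toMatrix D.basisU, toMatrix_A, Matrix.det_transpose]
  have h := (Int.castRingHom ℝ).map_det
    (D.M : Matrix (Fin (2 * n + 1)) (Fin (2 * n + 1)) ℤ)
  rw [D.M.det_coe, map_one] at h
  exact h.symm

open Polynomial in
theorem aeval_A_apply (q : ℝ[X]) (v : ℝ × (Fin n → ℂ)) :
    aeval D.A q v = (q.eval D.α * v.1, aeval D.N q v.2) := by
  induction q using Polynomial.induction_on' generalizing v with
  | add p q hp hq => simp [hp, hq, add_mul]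
  | monomial k c =>
    have h : ∀ w, (D.A ^ k) w = (D.α ^ k * w.1, (D.N ^ k) w.2) := by
      induction k with
      | zero => simp
      | succ k ih =>
        intro w
        rw [pow_succ, Module.End.mul_apply, ih, pow_succ D.N, Module.End.mul_apply, A_apply,
          N_apply, pow_succ D.α, mul_assoc]
    simp only [aeval_monomial, Module.End.mul_apply, Module.algebraMap_end_apply, h,
      eval_monomial]
    ext <;> simp [mul_assoc]

open Polynomial in
/-- If `Rᵀ` is semisimple over `ℝ`, then `M` is diagonalizable. -/
theorem isDiagonalizable_of_isSemisimple (h : D.N.IsSemisimple) : IsDiagonalizable D.M := by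
  obtain ⟨q, hq, hα, hN⟩ := exists_squarefree_aeval_prodMap h D.α
  have hA : aeval D.A q = 0 := by
    refine LinearMap.ext fun v => ?_
    rw [aeval_A_apply, hα, hN]
    simp
  set M' : Matrix (Fin (2 * n + 1)) (Fin (2 * n + 1)) ℝ :=
    (D.M : Matrix (Fin (2 * n + 1)) (Fin (2 * n + 1)) ℤ).map (Int.cast : ℤ → ℝ) with hM'
  have hmat : LinearMap.toMatrix D.basisU D.basisU D.A = M'ᵀ := D.toMatrix_A
  have hq1 : aeval M'ᵀ q = 0 := by
    have h2 := aeval_algHom_apply (LinearMap.toMatrixAlgEquiv D.basisU).toAlgHom D.A q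
    rw [hA, map_zero] at h2
    rw [← hmat]
    exact h2
  have hq2 : aeval M' q = 0 := by
    rw [← Matrix.transpose_inj, ← Matrix.transpose_zero (m := Fin (2 * n + 1)), ← hq1]
    simp [aeval_eq_sum_range, Matrix.transpose_sum, Matrix.transpose_pow]
  have h3 := Matrix.isSemisimple_map_ofReal M' hq hq2
  have h4 : M'.map ((↑) : ℝ → ℂ) =
      (D.M : Matrix (Fin (2 * n + 1)) (Fin (2 * n + 1)) ℤ).map (Int.cast : ℤ → ℂ) := by
    ext i j; simp [hM']
  rw [h4] at h3
  exact Matrix.exists_eq_conj_diagonal _ h3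

/-- The matrix `M` has no eigenvalue `1` over `ℝ`. -/
theorem eq_zero_of_fixed (c : Fin (2 * n + 1) → ℝ)
    (hc : ∀ i, ∑ j, ((D.M : Matrix (Fin (2 * n + 1)) (Fin (2 * n + 1)) ℤ) i j : ℝ) * c j = c i) :
    c = 0 := by
  by_contra h0
  have hev : (complexEnd D.M).HasEigenvalue 1 := by
    refine Module.End.hasEigenvalue_of_hasEigenvector (x := fun i => (c i : ℂ)) ⟨?_, ?_⟩
    · rw [Module.End.mem_eigenspace_iff, one_smul]
      ext i
      have := congrArg (fun x : ℝ => (x : ℂ)) (hc i)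
      simpa [complexEnd, Matrix.mulVec, dotProduct] using this
    · intro h
      apply h0
      ext i
      simpa using congrFun h i
  -- The only real eigenvalue is `α`, which differs from 1.
  refine D.im_ne_zero 1 hev (fun h => D.α_ne_one ?_) (by simp)
  exact_mod_cast h.symm

end Datum

end InoueType

/-! ### Integrals of periodic functions over a lattice cell, and differentiation under the integral.
-/

open MeasureTheory Topology in
/-- The integral of a lattice-periodic function over a fundamental domain is invariant under
measure preserving maps that permute the cosets of the lattice. -/
theorem ZSpan.setIntegral_fundamentalDomain_comp {ι V F : Type*} [Finite ι] [NormedAddCommGroup V]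
    [NormedSpace ℝ V] [MeasurableSpace V] [BorelSpace V] [FiniteDimensional ℝ V]
    [NormedAddCommGroup F] [NormedSpace ℝ F] (μ : Measure V) [μ.IsAddHaarMeasure]
    (b : Module.Basis ι ℝ V) (f : V → F)
    (hf : ∀ v ∈ Submodule.span ℤ (Set.range b), ∀ x, f (v + x) = f x) (e : V ≃ᵐ V)
    (he : MeasurePreserving e μ μ)
    (τ : Submodule.span ℤ (Set.range b) ≃ Submodule.span ℤ (Set.range b))
    (hτ : ∀ v : Submodule.span ℤ (Set.range b), ∀ x, e (v + x) = (τ v : V) + e x) :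
    ∫ x in ZSpan.fundamentalDomain b, f (e x) ∂μ = ∫ x in ZSpan.fundamentalDomain b, f x ∂μ := by
  have h1 := he.setIntegral_image_emb e.measurableEmbedding f (ZSpan.fundamentalDomain b)
  rw [← h1]
  have hfd := ZSpan.isAddFundamentalDomain b μ
  have : VAddInvariantMeasure (Submodule.span ℤ (Set.range b)) V μ :=
    ⟨fun c s _ => measure_preimage_add μ (c : V) s⟩
  -- The image of the cell under `e` is again a fundamental domain, `τ` matching the lattice
  -- actions, and a periodic function has the same integral over any two fundamental domains.
  refine (IsAddFundamentalDomain.setIntegral_eq (G := Submodule.span ℤ (Set.range b))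
    (hfd.image_of_equiv e.toEquiv (he.symm e).quasiMeasurePreserving τ.symm ?_) hfd ?_)
  · intro g x
    change e (((τ.symm g : Submodule.span ℤ (Set.range b)) : V) + x) = (g : V) + e x
    rw [hτ, τ.apply_symm_apply]
  · intro g x
    exact hf g g.2 x

open MeasureTheory Topology in
theorem ZSpan.setIntegral_fundamentalDomain_add {ι V F : Type*} [Finite ι] [NormedAddCommGroup V]
    [NormedSpace ℝ V] [MeasurableSpace V] [BorelSpace V] [FiniteDimensional ℝ V]
    [NormedAddCommGroup F] [NormedSpace ℝ F] (μ : Measure V) [μ.IsAddHaarMeasure]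
    (b : Module.Basis ι ℝ V) (f : V → F)
    (hf : ∀ v ∈ Submodule.span ℤ (Set.range b), ∀ x, f (v + x) = f x) (a : V) :
    ∫ x in ZSpan.fundamentalDomain b, f (x + a) ∂μ = ∫ x in ZSpan.fundamentalDomain b, f x ∂μ :=
  ZSpan.setIntegral_fundamentalDomain_comp μ b f hf (MeasurableEquiv.addRight a)
    (measurePreserving_add_right μ a) (Equiv.refl _) fun _ _ => add_assoc _ _ _

-- Determinant 1 makes `A` measure preserving, while `h1` and `h2` make it a bijection of the
-- lattice.
open MeasureTheory Topology in
theorem ZSpan.setIntegral_fundamentalDomain_linearEquiv {ι V F : Type*} [Finite ι]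
    [NormedAddCommGroup V]
    [NormedSpace ℝ V] [MeasurableSpace V] [BorelSpace V] [FiniteDimensional ℝ V]
    [NormedAddCommGroup F] [NormedSpace ℝ F] (μ : Measure V) [μ.IsAddHaarMeasure]
    (b : Module.Basis ι ℝ V) (f : V → F)
    (hf : ∀ v ∈ Submodule.span ℤ (Set.range b), ∀ x, f (v + x) = f x) (A : V →ₗ[ℝ] V)
    (hdet : LinearMap.det A = 1)
    (h1 : ∀ v ∈ Submodule.span ℤ (Set.range b), A v ∈ Submodule.span ℤ (Set.range b))
    (h2 : ∀ v ∈ Submodule.span ℤ (Set.range b), ∃ w ∈ Submodule.span ℤ (Set.range b), A w = v) :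
    ∫ x in ZSpan.fundamentalDomain b, f (A x) ∂μ = ∫ x in ZSpan.fundamentalDomain b, f x ∂μ := by
  let e : V ≃ₗ[ℝ] V := LinearMap.equivOfDetNeZero A (by rw [hdet]; exact one_ne_zero)
  have he : ∀ x, e x = A x := fun x => rfl
  let e' : V ≃ᵐ V := e.toContinuousLinearEquiv.toHomeomorph.toMeasurableEquiv
  have hmp : MeasurePreserving e' μ μ := by
    refine ⟨e'.measurable, ?_⟩
    have h := Measure.map_linearMap_addHaar_eq_smul_addHaar μ (f := A)
      (by rw [hdet]; exact one_ne_zero)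
    rw [hdet] at h
    change Measure.map A μ = μ
    simpa using h
  have hsymm : ∀ v ∈ Submodule.span ℤ (Set.range b),
      e.symm v ∈ Submodule.span ℤ (Set.range b) := by
    intro v hv
    obtain ⟨w, hw, rfl⟩ := h2 v hv
    rwa [← he, e.symm_apply_apply]
  exact ZSpan.setIntegral_fundamentalDomain_comp μ b f hf e' hmp
    { toFun := fun v => ⟨e v, h1 v v.2⟩
      invFun := fun v => ⟨e.symm v, hsymm v v.2⟩
      left_inv := fun v => by simp
      right_inv := fun v => by simp } fun v x => map_add A (v : V) x

open MeasureTheory Topology in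
/-- Differentiation under the integral sign of the translates of a `C¹` function. -/
theorem hasDerivAt_setIntegral_translate {X E F : Type*} [TopologicalSpace X] [T2Space X]
    [MeasurableSpace X] [OpensMeasurableSpace X] [NormedAddCommGroup E] [NormedSpace ℝ E]
    [FiniteDimensional ℝ E] [NormedAddCommGroup F] [NormedSpace ℝ F]
    {K : E → F} {U : Set E} (hU : IsOpen U) (hK : ContDiffOn ℝ 1 K U)
    {μ : Measure X} [IsFiniteMeasureOnCompacts μ] {C C' : Set X} (hC : MeasurableSet C)
    (hC' : IsCompact C') (hCC : C ⊆ C') {x : X → E} (hx : ContinuousOn x C')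
    (hxU : Set.MapsTo x C' U) (w : E) :
    HasDerivAt (fun r : ℝ => ∫ s in C, K (x s + r • w) ∂μ)
      (∫ s in C, fderiv ℝ K (x s) w ∂μ) 0 := by
  have : ProperSpace E := FiniteDimensional.proper ℝ E
  -- A closed thickening of the compact image stays inside `U`; on it the derivative is bounded,
  -- which yields the dominating constant.
  obtain ⟨δ, hδ, hsub⟩ := (hC'.image_of_continuousOn hx).exists_cthickening_subset_open hU
    hxU.image_subset
  have hcpt : IsCompact (Metric.cthickening δ (x '' C')) :=
    (hC'.image_of_continuousOn hx).cthickening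
  have hfd : ContinuousOn (fderiv ℝ K) U := hK.continuousOn_fderiv_of_isOpen hU le_rfl
  obtain ⟨B, hB⟩ := hcpt.exists_bound_of_continuousOn (hfd.mono hsub)
  -- For `|r| < ε` the shift `r • w` has norm at most `δ`; the `+ 1` covers `w = 0`.
  set ε : ℝ := δ / (‖w‖ + 1) with hε
  have hε0 : 0 < ε := by positivity
  have hmem : ∀ r ∈ Metric.ball (0 : ℝ) ε, ∀ s ∈ C',
      x s + r • w ∈ Metric.cthickening δ (x '' C') := by
    intro r hr s hs
    refine Metric.mem_cthickening_of_dist_le _ (x s) _ _ ⟨s, hs, rfl⟩ ?_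
    rw [dist_self_add_left, norm_smul]
    have hr' : ‖r‖ ≤ ε := by simpa using (mem_ball_zero_iff.1 hr).le
    calc ‖r‖ * ‖w‖ ≤ ε * (‖w‖ + 1) := by gcongr; linarith
      _ = δ := by rw [hε]; field_simp
  have hint : ∀ r ∈ Metric.ball (0 : ℝ) ε, IntegrableOn (fun s => K (x s + r • w)) C μ := by
    intro r hr
    refine IntegrableOn.mono_set (ContinuousOn.integrableOn_compact hC' ?_) hCC
    exact hK.continuousOn.comp (hx.add continuousOn_const) fun s hs => hsub (hmem r hr s hs)
  have h0 : (0 : ℝ) ∈ Metric.ball (0 : ℝ) ε := Metric.mem_ball_self hε0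
  have hfin : μ C < ⊤ := (measure_mono hCC).trans_lt hC'.measure_lt_top
  have hfdint : IntegrableOn (fun s => fderiv ℝ K (x s) w) C μ := by
    refine IntegrableOn.mono_set (ContinuousOn.integrableOn_compact hC' ?_) hCC
    exact (hfd.comp hx hxU).clm_apply continuousOn_const
  have key := hasDerivAt_integral_of_dominated_loc_of_deriv_le (μ := μ.restrict C)
    (F := fun (r : ℝ) s => K (x s + r • w)) (F' := fun (r : ℝ) s => fderiv ℝ K (x s + r • w) w)
    (bound := fun _ => B * ‖w‖) (Metric.ball_mem_nhds (0 : ℝ) hε0)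
    (Filter.eventually_of_mem (Metric.ball_mem_nhds (0 : ℝ) hε0) fun r hr => (hint r hr).1)
    (hint 0 h0) (by simpa using hfdint.1)
    (ae_restrict_of_forall_mem hC fun s hs r hr => ?_)
    (integrableOn_const hfin.ne)
    (ae_restrict_of_forall_mem hC fun s hs r hr => ?_)
  · simpa using key.2
  · exact (ContinuousLinearMap.le_opNorm _ _).trans
      (mul_le_mul_of_nonneg_right (hB _ (hmem r hr s (hCC hs))) (norm_nonneg _))
  · have hin := hsub (hmem r hr s (hCC hs))
    have hd : HasFDerivAt K (fderiv ℝ K (x s + r • w)) (x s + r • w) :=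
      ((hK.contDiffAt (hU.mem_nhds hin)).differentiableAt one_ne_zero).hasFDerivAt
    have hl : HasDerivAt (fun r : ℝ => x s + r • w) w r := by
      simpa using ((hasDerivAt_id r).smul_const w).const_add (x s)
    exact hd.comp_hasDerivAt r hl

/-! ### Charts of `T_M` and pull-back of forms to `ℍ × ℂⁿ`. -/

namespace InoueType

namespace Datum

variable {n : ℕ} (D : Datum n)

/-- The point `(i, 0)` of `ℍ × ℂ^n`. -/
def basePoint (n : ℕ) : HC n := ⟨(Complex.I, 0), by simp [mem_HC]⟩

/-- The chart of `T_M` at the image of `p`. -/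
def quotChart (p : HC n) : OpenPartialHomeomorph D.T (ℂ × (Fin n → ℂ)) :=
  (D.isLocalHomeomorph_mk.localInverseAt p).trans (chartAt (ℂ × (Fin n → ℂ)) p)

/-- The projection `ℍ × ℂ^n → T_M`, extended to `ℂ × ℂ^n`. -/
def proj (y : ℂ × (Fin n → ℂ)) : D.T :=
  Quotient.mk (MulAction.orbitRel D.G (HC n))
    ((chartAt (ℂ × (Fin n → ℂ)) (basePoint n)).symm y)

/-- All these charts have the same inverse map, so a form read in any of them is one global object
upstairs, namely `lift`. -/
theorem quotChart_symm (p : HC n) : ⇑(D.quotChart p).symm = D.proj := by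
  have h : ⇑(D.isLocalHomeomorph_mk.localInverseAt p).symm =
      Quotient.mk (MulAction.orbitRel D.G (HC n)) := D.isLocalHomeomorph_mk.localInverseAt_symm p
  funext y
  change (D.isLocalHomeomorph_mk.localInverseAt p).symm
    ((chartAt (ℂ × (Fin n → ℂ)) p).symm y) = _
  rw [h]
  rfl

theorem mem_target_chartAt (p q : HC n) :
    (p : ℂ × (Fin n → ℂ)) ∈ (chartAt (ℂ × (Fin n → ℂ)) q).target := by
  have h := (chartAt (ℂ × (Fin n → ℂ)) q).map_source (x := p) (by
    rw [TopologicalSpace.Opens.chartAt_eq, OpenPartialHomeomorph.subtypeRestr_source]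
    trivial)
  exact h

theorem mem_target_quotChart (p : HC n) : (p : ℂ × (Fin n → ℂ)) ∈ (D.quotChart p).target := by
  refine ⟨mem_target_chartAt p p, ?_⟩
  have h : (chartAt (ℂ × (Fin n → ℂ)) p).symm (p : ℂ × (Fin n → ℂ)) = p :=
    Subtype.ext (chartAt_symm_coe p (mem_target_chartAt p p))
  change (chartAt (ℂ × (Fin n → ℂ)) p).symm (p : ℂ × (Fin n → ℂ)) ∈
    (D.isLocalHomeomorph_mk.localInverseAt p).target
  rw [h]
  simp

theorem proj_coe (p : HC n) :
    D.proj (p : ℂ × (Fin n → ℂ)) = Quotient.mk (MulAction.orbitRel D.G (HC n)) p := by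
  have h : (chartAt (ℂ × (Fin n → ℂ)) (basePoint n)).symm (p : ℂ × (Fin n → ℂ)) = p :=
    Subtype.ext (chartAt_symm_coe _ (mem_target_chartAt p _))
  rw [proj, h]

theorem quotChart_mem_maximalAtlas (p : HC n) :
    D.quotChart p ∈ IsManifold.maximalAtlas 𝓘(ℂ, ℂ × (Fin n → ℂ)) ω D.T := by
  rw [IsManifold.maximalAtlas, mem_maximalAtlas_iff]
  rintro _ ⟨x, rfl⟩
  constructor <;> refine mem_groupoid_of_pregroupoid.2 ⟨?_, ?_⟩ <;>
    simpa [contDiffPregroupoid, quotChart] using! D.contDiffOn_transition _ _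

/-- Forms and `mfderiv` are taken over `ℝ`, so the holomorphic atlas must also be seen as a real
smooth one. -/
instance isManifold_T_real : IsManifold 𝓘(ℝ, ℂ × (Fin n → ℂ)) ∞ D.T := by
  refine isManifold_of_contDiffOn _ _ _ ?_
  rintro _ _ ⟨x, rfl⟩ ⟨x', rfl⟩
  simpa using! ((D.contDiffOn_transition _ _).restrict_scalars ℝ).of_le le_top

theorem quotChart_mem_maximalAtlas_real (p : HC n) :
    D.quotChart p ∈ IsManifold.maximalAtlas 𝓘(ℝ, ℂ × (Fin n → ℂ)) ∞ D.T := by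
  rw [IsManifold.maximalAtlas, mem_maximalAtlas_iff]
  rintro _ ⟨x, rfl⟩
  constructor <;> refine mem_groupoid_of_pregroupoid.2 ⟨?_, ?_⟩ <;>
    simpa [contDiffPregroupoid, quotChart] using!
      ((D.contDiffOn_transition _ _).restrict_scalars ℝ).of_le le_top

theorem mdifferentiableAt_proj (p : HC n) :
    MDifferentiableAt 𝓘(ℝ, ℂ × (Fin n → ℂ)) 𝓘(ℝ, ℂ × (Fin n → ℂ)) D.proj
      (p : ℂ × (Fin n → ℂ)) := by
  rw [← D.quotChart_symm p]
  exact (contMDiffAt_symm_of_mem_maximalAtlas (D.quotChart_mem_maximalAtlas_real p)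
    (D.mem_target_quotChart p)).mdifferentiableAt (by simp)

open ComplexGeometry

/-- The pull-back to `ℍ × ℂ^n` of a form on `T_M`. -/
def lift {k : ℕ} (η : DiffForm (ℂ × (Fin n → ℂ)) D.T k) (y : ℂ × (Fin n → ℂ)) :
    (ℂ × (Fin n → ℂ)) [⋀^Fin k]→L[ℝ] ℝ :=
  (η (D.proj y)).compContinuousLinearMap
    (mfderiv 𝓘(ℝ, ℂ × (Fin n → ℂ)) 𝓘(ℝ, ℂ × (Fin n → ℂ)) D.proj y)

theorem inChart_quotChart {k : ℕ} (η : DiffForm (ℂ × (Fin n → ℂ)) D.T k) (p : HC n) :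
    η.inChart (D.quotChart p) = D.lift η := by
  funext y
  unfold DiffForm.inChart lift
  rw [D.quotChart_symm p]

/-- The projection is unchanged by composition with `g`; the chain rule turns this into invariance
of the pull-back. -/
theorem lift_affine {k : ℕ} (η : DiffForm (ℂ × (Fin n → ℂ)) D.T k) {g : Equiv.Perm (HC n)}
    (hg : g ∈ D.G) {B : (ℂ × (Fin n → ℂ)) →L[ℝ] (ℂ × (Fin n → ℂ))} {c : ℂ × (Fin n → ℂ)}
    (hB : ∀ p : HC n, ((g p : HC n) : ℂ × (Fin n → ℂ)) = B p + c) (p : HC n) :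
    (D.lift η (B p + c)).compContinuousLinearMap B = D.lift η p := by
  have hproj : ∀ q : HC n, D.proj (B q + c) = D.proj q := by
    intro q
    rw [← hB, proj_coe, proj_coe]
    exact Quotient.sound (MulAction.orbitRel_apply.2 ⟨⟨g, hg⟩, rfl⟩)
  have haff : HasMFDerivAt 𝓘(ℝ, ℂ × (Fin n → ℂ)) 𝓘(ℝ, ℂ × (Fin n → ℂ))
      (fun y => B y + c) (p : ℂ × (Fin n → ℂ)) B :=
    (B.hasFDerivAt.add_const c).hasMFDerivAt
  have hd : MDifferentiableAt 𝓘(ℝ, ℂ × (Fin n → ℂ)) 𝓘(ℝ, ℂ × (Fin n → ℂ)) D.proj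
      (B p + c) := by
    rw [← hB]
    exact D.mdifferentiableAt_proj _
  have hev : D.proj =ᶠ[nhds (p : ℂ × (Fin n → ℂ))] D.proj ∘ fun y => B y + c := by
    filter_upwards [(HC n).isOpen.mem_nhds p.2] with y hy
    exact (hproj ⟨y, hy⟩).symm
  have hmf : mfderiv 𝓘(ℝ, ℂ × (Fin n → ℂ)) 𝓘(ℝ, ℂ × (Fin n → ℂ)) D.proj p =
      (mfderiv 𝓘(ℝ, ℂ × (Fin n → ℂ)) 𝓘(ℝ, ℂ × (Fin n → ℂ)) D.proj (B p + c)).comp B := by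
    have h := HasMFDerivAt.comp (p : ℂ × (Fin n → ℂ)) hd.hasMFDerivAt haff
    exact (h.congr_of_eventuallyEq hev).mfderiv
  -- The values of `η` at `x` and `x'` have types depending on the point; comparing them on vectors
  -- of the model space avoids a transport.
  have hη : ∀ x x' : D.T, x = x' → ∀ w : Fin k → ℂ × (Fin n → ℂ),
      (η x : (ℂ × (Fin n → ℂ)) [⋀^Fin k]→L[ℝ] ℝ) w =
        (η x' : (ℂ × (Fin n → ℂ)) [⋀^Fin k]→L[ℝ] ℝ) w := by
    rintro x _ rfl w
    rfl
  ext v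
  unfold lift
  rw [hmf]
  exact hη _ _ (hproj p) _

end Datum

end InoueType

/-! ### Exterior calculus in degrees one and two. -/

namespace ComplexGeometry

theorem removeNth_zero_three {α : Type*} (a b c : α) :
    Fin.removeNth (0 : Fin 3) ![a, b, c] = ![b, c] := by
  ext i; fin_cases i <;> rfl

theorem removeNth_one_three {α : Type*} (a b c : α) :
    Fin.removeNth (1 : Fin 3) ![a, b, c] = ![a, c] := by
  ext i; fin_cases i <;> rfl

theorem removeNth_two_three {α : Type*} (a b c : α) :
    Fin.removeNth (2 : Fin 3) ![a, b, c] = ![a, b] := by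
  ext i; fin_cases i <;> rfl

variable {E : Type*} [NormedAddCommGroup E] [NormedSpace ℝ E]

/-- A `1`-form, viewed as a linear form. -/
def oneFormCLM (θ : E [⋀^Fin 1]→L[ℝ] ℝ) : E →L[ℝ] ℝ :=
  (ContinuousAlternatingMap.ofSubsingleton ℝ E ℝ (0 : Fin 1)).symm θ

theorem oneFormCLM_apply (θ : E [⋀^Fin 1]→L[ℝ] ℝ) (v : E) : oneFormCLM θ v = θ ![v] := by
  change θ (fun _ => v) = θ ![v]
  congr 1
  ext i
  simp

theorem extDeriv_one_apply {θ : E → E [⋀^Fin 1]→L[ℝ] ℝ} {y : E} (h : DifferentiableAt ℝ θ y)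
    (a b : E) : extDeriv θ y ![a, b] =
      fderiv ℝ (fun z => θ z ![b]) y a - fderiv ℝ (fun z => θ z ![a]) y b := by
  rw [extDeriv_apply h, Fin.sum_univ_two]
  have h0 : Fin.removeNth (0 : Fin 2) ![a, b] = ![b] := by ext i; fin_cases i; rfl
  have h1 : Fin.removeNth (1 : Fin 2) ![a, b] = ![a] := by ext i; fin_cases i; rfl
  simp only [h0, h1]
  simp [sub_eq_add_neg]

theorem extDeriv_two_apply {η : E → E [⋀^Fin 2]→L[ℝ] ℝ} {y : E} (h : DifferentiableAt ℝ η y)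
    (a b c : E) : extDeriv η y ![a, b, c] =
      fderiv ℝ (fun z => η z ![b, c]) y a - fderiv ℝ (fun z => η z ![a, c]) y b +
        fderiv ℝ (fun z => η z ![a, b]) y c := by
  rw [extDeriv_apply h, Fin.sum_univ_three]
  simp only [removeNth_zero_three, removeNth_one_three, removeNth_two_three]
  simp [sub_eq_add_neg]

theorem wedgeOne_two_apply (θ : E [⋀^Fin 1]→L[ℝ] ℝ) (η : E [⋀^Fin 2]→L[ℝ] ℝ) (a b c : E) :
    wedgeOne θ η ![a, b, c] =
      oneFormCLM θ a * η ![b, c] - oneFormCLM θ b * η ![a, c] + oneFormCLM θ c * η ![a, b] := by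
  rw [wedgeOne_apply, Fin.sum_univ_three]
  simp only [removeNth_zero_three, removeNth_one_three, removeNth_two_three]
  have h : ∀ v : E, θ (fun _ => v) = oneFormCLM θ v := fun v => rfl
  simp [h, sub_eq_add_neg]

theorem two_form_swap (η : E [⋀^Fin 2]→L[ℝ] ℝ) (a b : E) : η ![a, b] = -η ![b, a] := by
  have h := η.toAlternatingMap.map_swap ![b, a] (i := 0) (j := 1) (by decide)
  rw [← ContinuousAlternatingMap.coe_toAlternatingMap, ← h]
  congr 1
  ext i
  fin_cases i <;> rfl

theorem contDiffOn_apply_const {k : ℕ} {r : ℕ∞ω} {η : E → E [⋀^Fin k]→L[ℝ] ℝ} {U : Set E}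
    (hη : ContDiffOn ℝ r η U) (v : Fin k → E) : ContDiffOn ℝ r (fun y => η y v) U :=
  (ContinuousAlternatingMap.apply ℝ E ℝ v).contDiff.comp_contDiffOn hη

/-- A smooth closed `1`-form on a convex open set has a primitive. -/
theorem exists_primitive [FiniteDimensional ℝ E] {θ : E → E [⋀^Fin 1]→L[ℝ] ℝ} {U : Set E}
    (hU : IsOpen U) (hconv : Convex ℝ U) (hθ : ContDiffOn ℝ ∞ θ U)
    (hd : ∀ y ∈ U, extDeriv θ y = 0) :
    ∃ f : E → ℝ, ContDiffOn ℝ 1 f U ∧ ∀ y ∈ U, HasFDerivAt f (oneFormCLM (θ y)) y := by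
  have hsm : ContDiffOn ℝ ∞ (fun y => oneFormCLM (θ y)) U := by
    rw [contDiffOn_clm_apply]
    intro v
    simp only [oneFormCLM_apply]
    exact contDiffOn_apply_const hθ _
  have hda : ∀ y ∈ U, DifferentiableAt ℝ (fun y => oneFormCLM (θ y)) y := fun y hy =>
    (hsm.contDiffAt (hU.mem_nhds hy)).differentiableAt (by simp)
  -- Closedness of `θ` says exactly that the derivative of `oneFormCLM ∘ θ` is symmetric.
  obtain ⟨f, hf⟩ := hconv.exists_forall_hasFDerivAt_of_fderiv_symmetric hU
    (hsm.differentiableOn (by simp)) fun y hy a b => by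
      have h1 : ∀ v w, fderiv ℝ (fun z => oneFormCLM (θ z)) y w v =
          fderiv ℝ (fun z => θ z ![v]) y w := fun v w => by
        have h := ((hda y hy).hasFDerivAt.clm_apply (hasFDerivAt_const v y)).fderiv
        simp only [oneFormCLM_apply] at h
        rw [h]
        simp
      have h2 := extDeriv_one_apply
        ((hθ.contDiffAt (hU.mem_nhds hy)).differentiableAt (by simp)) a b
      rw [hd y hy] at h2
      rw [h1, h1, ← sub_eq_zero, ← h2]
      rfl
  refine ⟨f, ?_, hf⟩
  intro y hy
  refine (contDiffAt_one_iff.2 ⟨_, U, hU.mem_nhds hy, hsm.continuousOn, hf⟩).contDiffWithinAt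

/-- If `θ = df` is invariant under an affine map `g`, then `f ∘ g - f` is constant. -/
theorem exists_add_const_of_invariant {θ : E → E [⋀^Fin 1]→L[ℝ] ℝ} {U : Set E}
    (hU : IsOpen U) (hconv : Convex ℝ U) {f : E → ℝ}
    (hf : ∀ y ∈ U, HasFDerivAt f (oneFormCLM (θ y)) y) (B : E →L[ℝ] E) (c : E)
    (hmaps : ∀ y ∈ U, B y + c ∈ U)
    (hinv : ∀ y ∈ U, (θ (B y + c)).compContinuousLinearMap B = θ y) :
    ∃ k : ℝ, ∀ y ∈ U, f (B y + c) = f y + k := by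
  have hd : ∀ y ∈ U, HasFDerivAt (fun y => f (B y + c) - f y) (0 : E →L[ℝ] ℝ) y := by
    intro y hy
    have h1 : HasFDerivAt (fun y => B y + c) B y := B.hasFDerivAt.add_const c
    have h2 := ((hf _ (hmaps y hy)).comp y h1).sub (hf y hy)
    have h3 : (oneFormCLM (θ (B y + c))).comp B - oneFormCLM (θ y) = 0 := by
      rw [← hinv y hy, sub_eq_zero]
      rfl
    rw [h3] at h2
    exact h2
  obtain ⟨k, hk⟩ := hU.exists_is_const_of_fderiv_eq_zero (𝕜 := ℝ) hconv.isPreconnected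
    (fun y hy => (hd y hy).differentiableAt.differentiableWithinAt) fun y hy => (hd y hy).fderiv
  exact ⟨k, fun y hy => by have := hk y hy; linarith⟩

/-- If `dΩ = df ∧ Ω`, then `exp (-f) Ω` is closed. -/
theorem fderiv_exp_neg_mul_cyclic {η : E → E [⋀^Fin 2]→L[ℝ] ℝ} {f : E → ℝ}
    {θ : E [⋀^Fin 1]→L[ℝ] ℝ} {y : E} (hη : DifferentiableAt ℝ η y)
    (hf : HasFDerivAt f (oneFormCLM θ) y) (hd : extDeriv η y = wedgeOne θ (η y)) (a b c : E) :
    fderiv ℝ (fun z => Real.exp (-f z) * η z ![b, c]) y a =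
      fderiv ℝ (fun z => Real.exp (-f z) * η z ![a, c]) y b -
        fderiv ℝ (fun z => Real.exp (-f z) * η z ![a, b]) y c := by
  -- Differentiating `exp (-f)` contributes `-θ(u)`; in the cyclic sum these terms cancel `θ ∧ η`.
  have hfd : ∀ v w u : E, fderiv ℝ (fun z => Real.exp (-f z) * η z ![v, w]) y u =
      Real.exp (-f y) * (fderiv ℝ (fun z => η z ![v, w]) y u - oneFormCLM θ u * η y ![v, w]) := by
    intro v w u
    have h := (hf.neg.exp).mul (hη.continuousAlternatingMap_apply_const ![v, w]).hasFDerivAt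
    have h' := HasFDerivAt.fderiv h
    change fderiv ℝ (fun z => Real.exp (-f z) * η z ![v, w]) y = _ at h'
    rw [h']
    simp
    ring
  have h1 := extDeriv_two_apply hη a b c
  rw [hd, wedgeOne_two_apply] at h1
  rw [hfd, hfd, hfd]
  linear_combination (-Real.exp (-f y)) * h1

end ComplexGeometry

/-! ### Averages over the tori `{Im w = t} / lattice`. -/

namespace InoueType

namespace Datum

variable {n : ℕ} (D : Datum n)

/-- The inclusion `ℝ × ℂ^n → ℂ × ℂ^n`. -/
def incl (n : ℕ) : (ℝ × (Fin n → ℂ)) →L[ℝ] (ℂ × (Fin n → ℂ)) :=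
  Complex.ofRealCLM.prodMap (ContinuousLinearMap.id ℝ (Fin n → ℂ))

theorem incl_apply (v : ℝ × (Fin n → ℂ)) : incl n v = ((v.1 : ℂ), v.2) := rfl

/-- The vertical direction `(i, 0)`. -/
def vert (n : ℕ) : ℂ × (Fin n → ℂ) := (Complex.I, 0)

/-- The point `(x + i t, z)` of the fibre over `t`. -/
def fiberPoint (t : ℝ) (v : ℝ × (Fin n → ℂ)) : ℂ × (Fin n → ℂ) := incl n v + t • vert n

theorem fiberPoint_mem {t : ℝ} (ht : 0 < t) (v : ℝ × (Fin n → ℂ)) : fiberPoint t v ∈ HC n := by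
  simpa [mem_HC, fiberPoint, incl_apply, vert] using ht

theorem fiberPoint_add (t : ℝ) (v w : ℝ × (Fin n → ℂ)) :
    fiberPoint t (v + w) = fiberPoint t v + incl n w := by
  simp only [fiberPoint, map_add]
  abel

theorem continuous_fiberPoint (t : ℝ) : Continuous (fiberPoint (n := n) t) :=
  (incl n).continuous.add continuous_const

theorem convex_HC : Convex ℝ (HC n : Set (ℂ × (Fin n → ℂ))) := by
  intro x hx y hy a b ha hb hab
  have hx' : 0 < x.1.im := hx
  have hy' : 0 < y.1.im := hy
  change 0 < (a • x + b • y).1.im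
  simp only [Prod.fst_add, Prod.smul_fst, Complex.add_im, Complex.smul_im, smul_eq_mul]
  rcases ha.eq_or_lt with rfl | ha
  · have : b = 1 := by linarith
    subst this; simpa using hy'
  · have := mul_pos ha hx'
    have := mul_nonneg hb hy'.le
    linarith

theorem span_basisU : Submodule.span ℤ (Set.range D.basisU) = D.lattice := by
  have : ⇑D.basisU = D.u := funext D.basisU_apply
  rw [this, lattice]

/-- The fundamental parallelotope of the lattice. -/
def cell : Set (ℝ × (Fin n → ℂ)) := ZSpan.fundamentalDomain D.basisU

theorem isCompact_closure_cell : IsCompact (closure D.cell) :=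
  (ZSpan.fundamentalDomain_isBounded D.basisU).isCompact_closure

theorem measurableSet_cell : MeasurableSet D.cell :=
  ZSpan.fundamentalDomain_measurableSet D.basisU

open MeasureTheory

/-- The integral of `k` over the torus `{Im w = t} / lattice`. -/
def mean (k : ℂ × (Fin n → ℂ) → ℝ) (t : ℝ) : ℝ :=
  ∫ v in D.cell, k (fiberPoint t v) ∂D.basisU.addHaar

/-- Invariance under the translations by lattice vectors. -/
def IsPeriodic (k : ℂ × (Fin n → ℂ) → ℝ) : Prop :=
  ∀ v ∈ D.lattice, ∀ p ∈ HC n, k (p + incl n v) = k p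

theorem integrableOn_cell {k : ℂ × (Fin n → ℂ) → ℝ} (hk : ContinuousOn k (HC n)) {t : ℝ}
    (ht : 0 < t) : IntegrableOn (fun v => k (fiberPoint t v)) D.cell D.basisU.addHaar := by
  refine IntegrableOn.mono_set (ContinuousOn.integrableOn_compact D.isCompact_closure_cell ?_)
    subset_closure
  exact hk.comp (continuous_fiberPoint t).continuousOn fun v _ => fiberPoint_mem ht v

theorem IsPeriodic.fiberPoint_add {k : ℂ × (Fin n → ℂ) → ℝ} (hk : D.IsPeriodic k) {t : ℝ}
    (ht : 0 < t) : ∀ v ∈ Submodule.span ℤ (Set.range D.basisU), ∀ x,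
      k (fiberPoint t (v + x)) = k (fiberPoint t x) := by
  intro v hv x
  rw [add_comm, Datum.fiberPoint_add]
  exact hk v (D.span_basisU ▸ hv) _ (fiberPoint_mem ht x)

theorem hasDerivAt_integral_cell {k : ℂ × (Fin n → ℂ) → ℝ} (hk : ContDiffOn ℝ 1 k (HC n))
    {t : ℝ} (ht : 0 < t) (w : ℂ × (Fin n → ℂ)) :
    HasDerivAt (fun r : ℝ => ∫ v in D.cell, k (fiberPoint t v + r • w) ∂D.basisU.addHaar)
      (∫ v in D.cell, fderiv ℝ k (fiberPoint t v) w ∂D.basisU.addHaar) 0 :=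
  hasDerivAt_setIntegral_translate (HC n).isOpen hk D.measurableSet_cell
    D.isCompact_closure_cell subset_closure (continuous_fiberPoint t).continuousOn
    (fun v _ => fiberPoint_mem ht v) w

theorem hasDerivAt_mean {k : ℂ × (Fin n → ℂ) → ℝ} (hk : ContDiffOn ℝ 1 k (HC n))
    {t : ℝ} (ht : 0 < t) :
    HasDerivAt (D.mean k)
      (∫ v in D.cell, fderiv ℝ k (fiberPoint t v) (vert n) ∂D.basisU.addHaar) t := by
  have h := D.hasDerivAt_integral_cell hk ht (vert n)
  -- Changing the height from `t` to `s` translates the fibre by `(s - t) • vert n`.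
  have h2 : D.mean k = fun s =>
      ∫ v in D.cell, k (fiberPoint t v + (s - t) • vert n) ∂D.basisU.addHaar := by
    funext s
    refine integral_congr_ae (Filter.Eventually.of_forall fun v => ?_)
    simp only [fiberPoint]
    congr 1
    module
  rw [h2]
  have h3 : HasDerivAt (fun s : ℝ => s - t) 1 t := (hasDerivAt_id t).sub_const t
  rw [← sub_self t] at h
  have h4 := HasDerivAt.comp (h := fun s : ℝ => s - t) t h h3
  rw [mul_one] at h4
  exact h4

/-- Translating a torus along itself does not change the integral of a periodic function, so the
derivative of the translated integral vanishes. -/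
theorem integral_fderiv_incl {k : ℂ × (Fin n → ℂ) → ℝ} (hk : ContDiffOn ℝ 1 k (HC n))
    (hper : D.IsPeriodic k) {t : ℝ} (ht : 0 < t) (a : ℝ × (Fin n → ℂ)) :
    ∫ v in D.cell, fderiv ℝ k (fiberPoint t v) (incl n a) ∂D.basisU.addHaar = 0 := by
  have h := D.hasDerivAt_integral_cell hk ht (incl n a)
  have h2 : (fun r : ℝ => ∫ v in D.cell, k (fiberPoint t v + r • incl n a) ∂D.basisU.addHaar) =
      fun _ => ∫ v in D.cell, k (fiberPoint t v) ∂D.basisU.addHaar := by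
    funext r
    rw [cell, ← ZSpan.setIntegral_fundamentalDomain_add D.basisU.addHaar D.basisU
      (fun v => k (fiberPoint t v)) (hper.fiberPoint_add D ht) (r • a)]
    simp only [Datum.fiberPoint_add, map_smul]
  rw [h2] at h
  exact h.unique (hasDerivAt_const _ _)

theorem mean_comp_A {k : ℂ × (Fin n → ℂ) → ℝ} (hper : D.IsPeriodic k) {t : ℝ} (ht : 0 < t) :
    ∫ v in D.cell, k (fiberPoint t (D.A v)) ∂D.basisU.addHaar = D.mean k t := by
  refine ZSpan.setIntegral_fundamentalDomain_linearEquiv D.basisU.addHaar D.basisU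
      (fun v => k (fiberPoint t v)) (hper.fiberPoint_add D ht) D.A D.det_A ?_ ?_
  · rw [span_basisU]
    exact fun v hv => D.A_mem hv
  · rw [span_basisU]
    exact fun v hv => D.exists_A_eq hv

theorem continuousOn_fderiv_apply {k : ℂ × (Fin n → ℂ) → ℝ} (hk : ContDiffOn ℝ 1 k (HC n))
    (w : ℂ × (Fin n → ℂ)) : ContinuousOn (fun y => fderiv ℝ k y w) (HC n) :=
  (hk.continuousOn_fderiv_of_isOpen (HC n).isOpen le_rfl).clm_apply continuousOn_const

/-- If the vertical derivative of `k` is a combination of horizontal derivatives of periodic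
functions, then the mean of `k` is constant. -/
theorem mean_eq_of_fderiv_vert {k k₁ k₂ : ℂ × (Fin n → ℂ) → ℝ} (hk : ContDiffOn ℝ 1 k (HC n))
    (hk₁ : ContDiffOn ℝ 1 k₁ (HC n)) (hk₂ : ContDiffOn ℝ 1 k₂ (HC n))
    (hp₁ : D.IsPeriodic k₁) (hp₂ : D.IsPeriodic k₂) (a b : ℝ × (Fin n → ℂ))
    (h : ∀ p ∈ HC n, fderiv ℝ k p (vert n) =
      fderiv ℝ k₁ p (incl n a) - fderiv ℝ k₂ p (incl n b)) {s t : ℝ} (hs : 0 < s) (ht : 0 < t) :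
    D.mean k s = D.mean k t := by
  have hd : ∀ r ∈ Set.Ioi (0 : ℝ), HasDerivAt (D.mean k) 0 r := by
    intro r hr
    have h1 := D.hasDerivAt_mean hk hr
    have h2 : ∫ v in D.cell, fderiv ℝ k (fiberPoint r v) (vert n) ∂D.basisU.addHaar = 0 := by
      simp_rw [fun v => h _ (fiberPoint_mem hr v)]
      rw [integral_sub (D.integrableOn_cell (continuousOn_fderiv_apply hk₁ _) hr)
        (D.integrableOn_cell (continuousOn_fderiv_apply hk₂ _) hr),
        D.integral_fderiv_incl hk₁ hp₁ hr, D.integral_fderiv_incl hk₂ hp₂ hr, sub_zero]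
    rwa [h2] at h1
  exact isOpen_Ioi.is_const_of_deriv_eq_zero (convex_Ioi 0).isPreconnected
    (fun r hr => (hd r hr).differentiableAt.differentiableWithinAt) (fun r hr => (hd r hr).deriv)
    hs ht

theorem mean_pos {k : ℂ × (Fin n → ℂ) → ℝ} (hk : ContinuousOn k (HC n))
    (hpos : ∀ p ∈ HC n, 0 < k p) {t : ℝ} (ht : 0 < t) : 0 < D.mean k t := by
  rw [mean, setIntegral_pos_iff_support_of_nonneg_ae
    (Filter.Eventually.of_forall fun v => (hpos _ (fiberPoint_mem ht v)).le)
    (D.integrableOn_cell hk ht)]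
  have : Function.support (fun v => k (fiberPoint t v)) = Set.univ :=
    Set.eq_univ_of_forall fun v => (hpos _ (fiberPoint_mem ht v)).ne'
  rw [this, Set.univ_inter]
  exact pos_iff_ne_zero.2 (ZSpan.measure_fundamentalDomain_ne_zero D.basisU)

/-! ### Invariance of lifted forms, and periodicity of the primitive of the Lee form. -/

/-- The translations by lattice vectors belong to `G_M`. -/
theorem transl_mem_G {v : ℝ × (Fin n → ℂ)} (hv : v ∈ D.lattice) : transl v ∈ D.G := by
  let L : AddSubgroup (ℝ × (Fin n → ℂ)) :=
    { carrier := {v | transl v ∈ D.G}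
      zero_mem' := by
        change transl 0 ∈ D.G
        rw [transl_zero]; exact one_mem _
      add_mem' := fun {v w} hv hw => by
        change transl (v + w) ∈ D.G
        rw [← transl_mul]; exact mul_mem hv hw
      neg_mem' := fun {v} hv => by
        change transl (-v) ∈ D.G
        rw [← transl_inv]; exact inv_mem hv }
  have h : D.lattice ≤ AddSubgroup.toIntSubmodule L := by
    rw [lattice, Submodule.span_le]
    rintro _ ⟨i, rfl⟩
    exact Subgroup.subset_closure (Set.mem_insert_of_mem _ ⟨i, rfl⟩)
  exact h hv

theorem g₀_mem_G : D.g₀ ∈ D.G := Subgroup.subset_closure (Set.mem_insert _ _)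

/-- The complex linear map `g₀`, as a real linear endomorphism of `ℂ × ℂ^n`. -/
def gLin : (ℂ × (Fin n → ℂ)) →L[ℝ] (ℂ × (Fin n → ℂ)) :=
  (D.α • ContinuousLinearMap.id ℝ ℂ).prodMap (LinearMap.toContinuousLinearMap D.N)

theorem gLin_apply (p : ℂ × (Fin n → ℂ)) : D.gLin p = (D.α * p.1, D.N p.2) := by
  ext <;> simp [gLin]

theorem gLin_incl (v : ℝ × (Fin n → ℂ)) : D.gLin (incl n v) = incl n (D.A v) := by
  rw [gLin_apply, incl_apply, incl_apply, A_apply, N_apply]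
  simp

theorem gLin_fiberPoint (t : ℝ) (v : ℝ × (Fin n → ℂ)) :
    D.gLin (fiberPoint t v) = fiberPoint (D.α * t) (D.A v) := by
  have h : D.gLin (vert n) = D.α • vert n := by
    rw [gLin_apply, vert]
    ext <;> simp
  rw [fiberPoint, map_add, gLin_incl, map_smul, h, fiberPoint, smul_smul, mul_comm]

theorem gLin_mem {p : ℂ × (Fin n → ℂ)} (hp : p ∈ HC n) : D.gLin p ∈ HC n := by
  rw [mem_HC] at hp ⊢
  rw [gLin_apply]
  simpa using mul_pos D.α_pos hp

theorem add_incl_mem {p : ℂ × (Fin n → ℂ)} (hp : p ∈ HC n) (v : ℝ × (Fin n → ℂ)) :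
    p + incl n v ∈ HC n := by
  rw [mem_HC] at hp ⊢
  simpa [incl_apply] using hp

open ComplexGeometry

section Lift

variable {k : ℕ} (η : DiffForm (ℂ × (Fin n → ℂ)) D.T k)

theorem lift_add_incl {v : ℝ × (Fin n → ℂ)} (hv : v ∈ D.lattice) {p : ℂ × (Fin n → ℂ)}
    (hp : p ∈ HC n) : D.lift η (p + incl n v) = D.lift η p :=
  D.lift_affine η (D.transl_mem_G hv) (B := ContinuousLinearMap.id ℝ _) (c := incl n v)
    (fun _ => rfl) ⟨p, hp⟩

theorem lift_gLin {p : ℂ × (Fin n → ℂ)} (hp : p ∈ HC n) :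
    (D.lift η (D.gLin p)).compContinuousLinearMap D.gLin = D.lift η p := by
  have h := D.lift_affine η D.g₀_mem_G (B := D.gLin) (c := 0)
    (fun q => by rw [add_zero, gLin_apply]; rfl) ⟨p, hp⟩
  rwa [add_zero] at h

end Lift

/-- A primitive of a closed invariant `1`-form is invariant under the lattice. -/
theorem primitive_add_incl {θ : ℂ × (Fin n → ℂ) → (ℂ × (Fin n → ℂ)) [⋀^Fin 1]→L[ℝ] ℝ}
    {f : ℂ × (Fin n → ℂ) → ℝ} (hf : ∀ y ∈ HC n, HasFDerivAt f (oneFormCLM (θ y)) y)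
    (hper : ∀ v ∈ D.lattice, ∀ p ∈ HC n, θ (p + incl n v) = θ p)
    {c₀ : ℝ} (hc₀ : ∀ p ∈ HC n, f (D.gLin p) = f p + c₀) {v : ℝ × (Fin n → ℂ)}
    (hv : v ∈ D.lattice) {p : ℂ × (Fin n → ℂ)} (hp : p ∈ HC n) : f (p + incl n v) = f p := by
  have h1 : ∀ i, ∃ c : ℝ, ∀ p ∈ HC n, f (p + incl n (D.u i)) = f p + c := fun i =>
    exists_add_const_of_invariant (HC n).isOpen convex_HC hf (ContinuousLinearMap.id ℝ _)
      (incl n (D.u i)) (fun y hy => add_incl_mem hy _)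
      fun y hy => hper _ (Submodule.subset_span ⟨i, rfl⟩) y hy
  choose c hc using h1
  -- The linear extension of the constants `c i`: for `v` in the lattice, `ℓ v` is the increment of
  -- `f` under translation by `v`.
  let ℓ : (ℝ × (Fin n → ℂ)) →ₗ[ℝ] ℝ := D.basisU.constr ℝ c
  have hℓ : ∀ i, ℓ (D.u i) = c i := fun i => by
    rw [← basisU_apply]
    exact D.basisU.constr_basis ℝ c i
  let L : AddSubgroup (ℝ × (Fin n → ℂ)) :=
    { carrier := {v | ∀ p ∈ HC n, f (p + incl n v) = f p + ℓ v}
      zero_mem' := fun p _ => by simp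
      add_mem' := fun {v w} hv hw p hp => by
        rw [map_add, ← add_assoc, hw _ (add_incl_mem hp v), hv p hp, map_add, add_assoc]
      neg_mem' := fun {v} hv p hp => by
        have h := hv _ (add_incl_mem hp (-v))
        rw [add_assoc, ← map_add, neg_add_cancel, map_zero, add_zero] at h
        have h2 : ℓ (-v) = -ℓ v := map_neg ℓ v
        rw [h, h2, add_neg_cancel_right] }
  have hL : D.lattice ≤ AddSubgroup.toIntSubmodule L := by
    rw [lattice, Submodule.span_le]
    rintro _ ⟨i, rfl⟩ p hp
    rw [hc i p hp, hℓ]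
  -- Evaluate `f` at `g₀ (p + w) = g₀ p + A w` in two ways; `c₀` cancels.
  have hfix : ∀ w ∈ D.lattice, ℓ (D.A w) = ℓ w := by
    intro w hw
    obtain ⟨p, hp⟩ := basePoint n
    have h2 := hc₀ _ (add_incl_mem hp w)
    rw [map_add, gLin_incl, hL (D.A_mem hw) _ (D.gLin_mem hp), hL hw p hp, hc₀ p hp] at h2
    linarith
  -- On the `u_i`, invariance of `ℓ` under `A` reads `M c = c`.
  have hc0 : c = 0 := D.eq_zero_of_fixed c fun i => by
    have h := hfix _ (Submodule.subset_span ⟨i, rfl⟩ : D.u i ∈ D.lattice)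
    rw [A_u, map_sum, hℓ] at h
    simp_rw [map_zsmul, hℓ, zsmul_eq_mul] at h
    exact h
  have hℓ0 : ℓ = 0 := by
    refine D.basisU.ext fun i => ?_
    rw [basisU_apply, hℓ, hc0]
    rfl
  rw [hL hv p hp, hℓ0, LinearMap.zero_apply, add_zero]

/-! ### The lifted structure and the averaged Hermitian form. -/

section LCK

variable (S : LCKStructure (ℂ × (Fin n → ℂ)) D.T)

theorem contDiffOn_lift_Ω : ContDiffOn ℝ ∞ (D.lift S.Ω) (HC n) := fun y hy => by
  have h := S.smooth_Ω _ (D.quotChart_mem_maximalAtlas ⟨y, hy⟩)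
  rw [inChart_quotChart] at h
  exact (h.contDiffAt ((D.quotChart ⟨y, hy⟩).open_target.mem_nhds
    (D.mem_target_quotChart ⟨y, hy⟩))).contDiffWithinAt

theorem contDiffOn_lift_lee : ContDiffOn ℝ ∞ (D.lift S.lee) (HC n) := fun y hy => by
  have h := S.smooth_lee _ (D.quotChart_mem_maximalAtlas ⟨y, hy⟩)
  rw [inChart_quotChart] at h
  exact (h.contDiffAt ((D.quotChart ⟨y, hy⟩).open_target.mem_nhds
    (D.mem_target_quotChart ⟨y, hy⟩))).contDiffWithinAt

theorem lift_Ω_invariant {y : ℂ × (Fin n → ℂ)} (hy : y ∈ HC n) (v w : ℂ × (Fin n → ℂ)) :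
    D.lift S.Ω y ![Complex.I • v, Complex.I • w] = D.lift S.Ω y ![v, w] := by
  have h := S.invariant _ (D.quotChart_mem_maximalAtlas ⟨y, hy⟩) y
    (D.mem_target_quotChart ⟨y, hy⟩) v w
  rwa [inChart_quotChart] at h

theorem lift_Ω_pos {y : ℂ × (Fin n → ℂ)} (hy : y ∈ HC n) {v : ℂ × (Fin n → ℂ)} (hv : v ≠ 0) :
    0 < D.lift S.Ω y ![v, Complex.I • v] := by
  have h := S.positive _ (D.quotChart_mem_maximalAtlas ⟨y, hy⟩) y
    (D.mem_target_quotChart ⟨y, hy⟩) v hv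
  rwa [inChart_quotChart] at h

theorem extDeriv_lift_lee {y : ℂ × (Fin n → ℂ)} (hy : y ∈ HC n) :
    extDeriv (D.lift S.lee) y = 0 := by
  have h := S.lee_closed _ (D.quotChart_mem_maximalAtlas ⟨y, hy⟩) y
    (D.mem_target_quotChart ⟨y, hy⟩)
  rwa [inChart_quotChart] at h

theorem extDeriv_lift_Ω {y : ℂ × (Fin n → ℂ)} (hy : y ∈ HC n) :
    extDeriv (D.lift S.Ω) y = wedgeOne (D.lift S.lee y) (D.lift S.Ω y) := by
  have h := S.d_Ω _ (D.quotChart_mem_maximalAtlas ⟨y, hy⟩) y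
    (D.mem_target_quotChart ⟨y, hy⟩)
  rwa [inChart_quotChart, inChart_quotChart] at h

/-- Type `(1,1)` allows applying `i` to both arguments; `i² = -1` and antisymmetry then contribute
two signs that cancel. -/
theorem two_form_J_symm {y : ℂ × (Fin n → ℂ)} (hy : y ∈ HC n) (v w : ℂ × (Fin n → ℂ)) :
    D.lift S.Ω y ![v, Complex.I • w] = D.lift S.Ω y ![w, Complex.I • v] := by
  rw [← D.lift_Ω_invariant S hy v, two_form_swap, smul_smul, Complex.I_mul_I]
  have h := (D.lift S.Ω y).vecCons_smul ![Complex.I • v] (-1 : ℝ) w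
  simp only [neg_smul, one_smul] at h ⊢
  rw [h, neg_neg]

end LCK

/-- If `T_M` has a locally conformally Kähler structure, then `Rᵀ` is a similitude of a positive
definite symmetric bilinear form on `ℂ^n`. -/
theorem exists_similitude (S : LCKStructure (ℂ × (Fin n → ℂ)) D.T) :
    ∃ (B : LinearMap.BilinForm ℝ (Fin n → ℂ)) (c : ℝ), c ≠ 0 ∧
    (∀ x y, B x y = B y x) ∧ (∀ x, x ≠ 0 → 0 < B x x) ∧
      ∀ x y, B (D.N x) (D.N y) = c * B x y := by
  obtain ⟨f, hfC, hf⟩ := exists_primitive (HC n).isOpen convex_HC (D.contDiffOn_lift_lee S)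
    fun y hy => D.extDeriv_lift_lee S hy
  obtain ⟨c₀, hc₀⟩ := exists_add_const_of_invariant (HC n).isOpen convex_HC hf D.gLin 0
    (fun y hy => by rw [add_zero]; exact D.gLin_mem hy)
    (fun y hy => by rw [add_zero]; exact D.lift_gLin S.lee hy)
  simp only [add_zero] at hc₀
  have hfper : ∀ v ∈ D.lattice, ∀ p ∈ HC n, f (p + incl n v) = f p := fun v hv p hp =>
    D.primitive_add_incl hf (fun v hv p hp => D.lift_add_incl S.lee hv hp) hc₀ hv hp
  let K : (ℂ × (Fin n → ℂ)) → (ℂ × (Fin n → ℂ)) → (ℂ × (Fin n → ℂ)) → ℝ := fun a b y =>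
    Real.exp (-f y) * D.lift S.Ω y ![a, b]
  have hK : ∀ a b, ContDiffOn ℝ 1 (K a b) (HC n) := fun a b =>
    hfC.neg.exp.mul ((contDiffOn_apply_const (D.contDiffOn_lift_Ω S) _).of_le (by simp))
  have hKper : ∀ a b, D.IsPeriodic (K a b) := fun a b v hv p hp => by
    simp only [K, hfper v hv p hp, D.lift_add_incl S.Ω hv hp]
  have hKvert : ∀ a b : ℝ × (Fin n → ℂ), ∀ s t : ℝ, 0 < s → 0 < t →
      D.mean (K (incl n a) (incl n b)) s = D.mean (K (incl n a) (incl n b)) t := by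
    intro a b s t hs ht
    -- Closedness of `e^{-f} Ω` evaluated on `vert n`, `incl n a`, `incl n b`; the fields are
    -- constant, so no bracket terms occur.
    refine D.mean_eq_of_fderiv_vert (hK _ _) (hK (vert n) (incl n b)) (hK (vert n) (incl n a))
      (hKper _ _) (hKper _ _) a b (fun p hp => ?_) hs ht
    exact fderiv_exp_neg_mul_cyclic
      (((D.contDiffOn_lift_Ω S).contDiffAt ((HC n).isOpen.mem_nhds hp)).differentiableAt (by simp))
      (hf p hp) (D.extDeriv_lift_Ω S hp) _ _ _
  have hKg : ∀ a b, ∀ p ∈ HC n,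
      K (D.gLin a) (D.gLin b) (D.gLin p) = Real.exp (-c₀) * K a b p := by
    intro a b p hp
    have h : D.lift S.Ω p ![a, b] = D.lift S.Ω (D.gLin p) ![D.gLin a, D.gLin b] := by
      rw [← D.lift_gLin S.Ω hp, ContinuousAlternatingMap.compContinuousLinearMap_apply]
      congr 1
      ext i : 1
      fin_cases i <;> rfl
    simp only [K]
    rw [h, hc₀ p hp, neg_add, Real.exp_add]
    ring
  have hKmean : ∀ a b t, 0 < t →
      D.mean (K (D.gLin a) (D.gLin b)) (D.α * t) = Real.exp (-c₀) * D.mean (K a b) t := by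
    intro a b t ht
    rw [← D.mean_comp_A (hKper _ _) (mul_pos D.α_pos ht), mean, ← MeasureTheory.integral_const_mul]
    simp_rw [← gLin_fiberPoint, fun v => hKg a b _ (fiberPoint_mem ht v)]
  have hint : ∀ a b, MeasureTheory.IntegrableOn (fun v => K a b (fiberPoint 1 v)) D.cell
      D.basisU.addHaar := fun a b => D.integrableOn_cell (hK a b).continuousOn one_pos
  let ι : (Fin n → ℂ) → ℂ × (Fin n → ℂ) := fun x => (0, x)
  have hι : ∀ x, ι x = incl n (0, x) := fun x => by simp [ι, incl_apply]
  have hιI : ∀ x, Complex.I • ι x = ι (Complex.I • x) := fun x => by simp [ι]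
  have hιN : ∀ x, D.gLin (ι x) = ι (D.N x) := fun x => by rw [gLin_apply]; simp [ι]
  -- On `{0} × ℂⁿ` multiplication by `i` stays horizontal, so `hKvert` applies to both arguments; in
  -- the `w` direction it would not.
  let b : (Fin n → ℂ) → (Fin n → ℂ) → ℝ := fun x y => D.mean (K (ι x) (Complex.I • ι y)) 1
  have hadd : ∀ x x' y, b (x + x') y = b x y + b x' y := by
    intro x x' y
    simp only [b, mean]
    rw [← MeasureTheory.integral_add (hint _ _) (hint _ _)]
    congr 1
    funext v
    have h : ι (x + x') = ι x + ι x' := by simp [ι]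
    simp only [K, h]
    rw [ContinuousAlternatingMap.vecCons_add, mul_add]
  have hsmul : ∀ (r : ℝ) x y, b (r • x) y = r * b x y := by
    intro r x y
    simp only [b, mean]
    rw [← MeasureTheory.integral_const_mul]
    congr 1
    funext v
    have h : ι (r • x) = r • ι x := by simp [ι]
    simp only [K, h]
    rw [ContinuousAlternatingMap.vecCons_smul, smul_eq_mul]
    ring
  have hsymm : ∀ x y, b x y = b y x := by
    intro x y
    simp only [b, mean]
    congr 1
    funext v
    simp only [K]
    rw [D.two_form_J_symm S (fiberPoint_mem one_pos v)]
  refine ⟨LinearMap.mk₂ ℝ b hadd hsmul (fun x y y' => ?_) (fun r x y => ?_), Real.exp (-c₀),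
    (Real.exp_pos _).ne', hsymm, fun x hx => ?_, fun x y => ?_⟩
  · rw [hsymm, hadd, hsymm y, hsymm y']
  · rw [hsymm, hsmul, hsymm y]
    rfl
  · refine D.mean_pos (hK _ _).continuousOn (fun p hp => ?_) one_pos
    refine mul_pos (Real.exp_pos _) (D.lift_Ω_pos S hp fun h => hx ?_)
    exact congrArg Prod.snd h
  · change D.mean (K (ι (D.N x)) (Complex.I • ι (D.N y))) 1 = _ * D.mean _ 1
    have hNI : D.N (Complex.I • y) = Complex.I • D.N y := by
      rw [N_apply, N_apply, Matrix.mulVec_smul]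
    -- The scaling by `g₀` lands on the fibre over `α`, with `Rᵀ` commuting with `i`; independence
    -- of the height leads back to the fibre over 1.
    rw [← hKmean _ _ 1 one_pos, mul_one, hιI, hιI, hιN, hιN, hNI, hι, hι]
    exact hKvert _ _ _ _ one_pos D.α_pos

end Datum

end InoueType

end

theorem proposition4p4 (n : ℕ) (hn : 0 < n) (D : InoueType.Datum n)
    (hD : ¬ InoueType.IsDiagonalizable D.M) :
    IsEmpty (ComplexGeometry.LCKStructure (ℂ × (Fin n → ℂ)) D.T) := by
  refine ⟨fun S => hD ?_⟩
  obtain ⟨B, c, hc, hsymm, hpos, hN⟩ := D.exists_similitude S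
  exact D.isDiagonalizable_of_isSemisimple
    (Module.End.isSemisimple_of_similitude B hsymm hpos D.N hc hN)
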